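/- Let $L>0$, $\omega:=(0,L)\times(0,1)$ with variables $(x_1,s)$, and let $\gamma:[0,1]\to\mathbb{R}^3$, $\gamma(s)=(0,\gamma_2(s),\gamma_3(s))$, be a simple planar curve of class $C^6$ parametrized by arclength. Set $\tau:=\dot\gamma$, $n:=(0,-\tau_3,\tau_2)$ and $k:=\dot\tau\cdot n$. For a displacement $\phi:\omega\to\mathbb{R}^3$ of the cylindrical surface $\{x_1e_1+\gamma(s)\}$ let $$e(\phi):=\begin{pmatrix}\partial_1\phi_1&\frac12(\partial_s\phi_1+\partial_1\phi\cdot\tau)\\ \frac12(\partial_s\phi_1+\partial_1\phi\cdot\tau)&\partial_s\phi\cdot\tau\end{pmatrix}.$$ Let $\mathcal{B}$ be the set of all $b\in L^2(\omega)$ for which there exists $v\in L^2(\omega;\mathbb{R}^3)$ with weak derivative $\partial_sv\in L^2(\omega;\mathbb{R}^3)$ such that $\partial_sv\cdot\tau=0$ a.e. in $\omega$ and, in the sense of distributions on $\omega$, $\partial_s(\partial_sv\cdot n)=b$ and $\partial_1^2v\cdot\tau=0$. Lemma. Assume that there are finitely many points $0=p_0<p_1<\dots<p_m=1$ such that, for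 every $i=0,\dots,m-1$, either $k>0$ on all of $(p_i,p_{i+1})$, or $k<0$ on all of $(p_i,p_{i+1})$, or $k=0$ on all of $(p_i,p_{i+1})$. Then for every $b\in\mathcal{B}$ there exists a family $(\phi^\varepsilon)_{\varepsilon>0}\subset C^5(\overline\omega;\mathbb{R}^3)$ such that $e(\phi^\varepsilon)=0$ in $\omega$ for every $\varepsilon>0$ and $$\partial_s(\partial_s\phi^\varepsilon\cdot n)\to b\quad\text{strongly in }L^2(\omega)\text{ as }\varepsilon\to0.$$ -/

import Mathlib

open MeasureTheory Filter Topology Set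
open scoped ContDiff RealInnerProductSpace

noncomputable section

namespace ThinBeam

/-- Three-dimensional Euclidean space; the indices `0, 1, 2` stand for the directions
`e₁, e₂, e₃`. -/
abbrev E3 : Type := EuclideanSpace ℝ (Fin 3)

/-- The tangent vector `τ = γ'` on `[0,1]` (one-sided derivatives at the end points). -/
def tangent (γ : ℝ → E3) (s : ℝ) : E3 := derivWithin γ (Icc 0 1) s

/-- The normal vector `n = (0, -τ₃, τ₂)`. -/
def normal (γ : ℝ → E3) (s : ℝ) : E3 := !₂[0, -(tangent γ s 2), tangent γ s 1]

/-- The signed curvature `k = τ' · n` on `[0,1]`. -/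
def curvature (γ : ℝ → E3) (s : ℝ) : ℝ :=
  ⟪derivWithin (tangent γ) (Icc 0 1) s, normal γ s⟫

/-- A simple planar curve `γ = (0, γ₂, γ₃)` on `[0,1]` of class `C⁶`, parametrized by arclength.
Simple means without self-intersections, except that the two end points may coincide. Values
of `γ` outside `[0,1]` play no role. -/
structure IsSimplePlanarCurve (γ : ℝ → E3) : Prop where
  contDiffOn : ContDiffOn ℝ 6 γ (Icc 0 1)
  planar : ∀ s ∈ Icc (0 : ℝ) 1, γ s 0 = 0
  unit_speed : ∀ s ∈ Icc (0 : ℝ) 1, ‖tangent γ s‖ = 1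
  simple : ∀ s ∈ Icc (0 : ℝ) 1, ∀ t ∈ Icc (0 : ℝ) 1, s < t → γ s = γ t → s = 0 ∧ t = 1

/-- The open rectangle `ω = (0,L) × (0,1)` of the variables `(x₁, s)`. -/
def omega (L : ℝ) : Set (ℝ × ℝ) := Ioo 0 L ×ˢ Ioo 0 1

/-- The closed rectangle `[0,L] × [0,1]`. -/
def omegaBar (L : ℝ) : Set (ℝ × ℝ) := Icc 0 L ×ˢ Icc 0 1

/-- Lebesgue measure on `ω`. -/
def muOmega (L : ℝ) : Measure (ℝ × ℝ) := volume.restrict (omega L)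

section PartialDerivatives

variable {F : Type*} [NormedAddCommGroup F] [NormedSpace ℝ F]

/-- The classical partial derivative `∂₁ f` in the variable `x₁`. -/
def pd1 (f : ℝ × ℝ → F) (p : ℝ × ℝ) : F := deriv (fun x => f (x, p.2)) p.1

/-- The classical partial derivative `∂ₛ f` in the variable `s`. -/
def pds (f : ℝ × ℝ → F) (p : ℝ × ℝ) : F := deriv (fun s => f (p.1, s)) p.2

/-- Test functions: elements of `C₀^∞(ω)`. -/
structure IsTest (L : ℝ) (ψ : ℝ × ℝ → ℝ) : Prop where
  smooth : ContDiff ℝ ∞ ψ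
  compact : HasCompactSupport ψ
  support : tsupport ψ ⊆ omega L

/-- `∂ₛ f = g` in the sense of distributions on `ω`
(used for `f`, `g` square integrable on `ω`). -/
def HasWeakPds (L : ℝ) (f g : ℝ × ℝ → F) : Prop :=
  ∀ ψ : ℝ × ℝ → ℝ, IsTest L ψ →
    ∫ p, pds ψ p • f p ∂(muOmega L) = -∫ p, ψ p • g p ∂(muOmega L)

end PartialDerivatives

/-- `∂₁² v · τ = 0` in the sense of distributions on `ω`, for `v` square integrable. As `τ` depends
on `s` only, the distribution `∂₁² v · τ` takes the value `∫ (∂₁² ψ) (v · τ)` at `ψ`. -/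
def WeakPd11TangentZero (L : ℝ) (γ : ℝ → E3) (v : ℝ × ℝ → E3) : Prop :=
  ∀ ψ : ℝ × ℝ → ℝ, IsTest L ψ →
    ∫ p, pd1 (pd1 ψ) p * ⟪v p, tangent γ p.2⟫ ∂(muOmega L) = 0

/-- The class `𝓑` of limit bending moments: `b ∈ L²(ω)` such that there is `v ∈ L²(ω; ℝ³)` with
weak derivative `w = ∂ₛ v ∈ L²(ω; ℝ³)`, `∂ₛ v · τ = 0`, `∂ₛ(∂ₛ v · n) = b` and
`∂₁² v · τ = 0`. -/
def classB (L : ℝ) (γ : ℝ → E3) : Set (ℝ × ℝ → ℝ) :=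
  {b | MemLp b 2 (muOmega L) ∧
    ∃ v w : ℝ × ℝ → E3,
      MemLp v 2 (muOmega L) ∧ MemLp w 2 (muOmega L) ∧
      HasWeakPds L v w ∧
      (∀ᵐ p ∂(muOmega L), ⟪w p, tangent γ p.2⟫ = 0) ∧
      HasWeakPds L (fun p => ⟪w p, normal γ p.2⟫) b ∧
      WeakPd11TangentZero L γ v}

/-- The symmetric gradient `e(φ)` of a displacement of the cylindrical surface
`{x₁ e₁ + γ(s)}`. -/
def symGrad (γ : ℝ → E3) (φ : ℝ × ℝ → E3) (p : ℝ × ℝ) : Matrix (Fin 2) (Fin 2) ℝ :=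
  !![pd1 φ p 0, (1 / 2) * (pds φ p 0 + ⟪pd1 φ p, tangent γ p.2⟫);
     (1 / 2) * (pds φ p 0 + ⟪pd1 φ p, tangent γ p.2⟫), ⟪pds φ p, tangent γ p.2⟫]

/-- The bending moment `∂ₛ(∂ₛ φ · n)` of a (smooth) displacement `φ`. -/
def bending (γ : ℝ → E3) (φ : ℝ × ℝ → E3) : ℝ × ℝ → ℝ :=
  pds (fun q => ⟪pds φ q, normal γ q.2⟫)

end ThinBeam

end

/-! The proof is a duality argument in the Hilbert space `L²(ω)`. The bending moments of `C⁵`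
infinitesimal isometries form a subspace, whose closure is its double orthogonal. It therefore
suffices that every `h ∈ L²(ω)` orthogonal to all these moments is orthogonal to each `b ∈ 𝓑`.

Two explicit families of isometries are tested against `h`. Displacements affine in `x₁` realise
every moment `(α₀ + α₁ x₁) g(s)` with `g` smooth (`exists_hasBending_affine`), so the integral of
`h` in `x₁` against any affine function vanishes for a.e. `s`. Normal displacements `f(x₁) W(s)
n(s)` with `k W = 0` have moment `f W''` (`hasBending_normal`), so each weighted average `∫ f h dx₁`
annihilates all such `W''`.

Since `h` does not see moments affine in `x₁`, `b` may be corrected by such a term so that only its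
averages against second derivatives `F''` matter (`exists_second_primitive`). The average `V = ∫ F''
v dx₁` satisfies `V · τ = 0` because `∂₁² v · τ = 0`. Its in-plane derivative is normal, so in the
plane `V = W n`, where `W''` is the average of `b` and `k W = 0` (`exists_normal_component`).

This `W` is not smooth, and the structure of `k` replaces an approximation of it. On intervals where
`k = 0` the average of `h` is affine, so two integrations by parts reduce `∫ h W''` to boundary
terms. These cancel between adjacent flat intervals, vanish next to curved ones, where `W = W' = 0`,
and vanish at the two ends, where nothing restricts the competitors
(`integral_mul_eq_zero_of_annihilates`). Finally, orthogonality of all averages implies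
orthogonality in `L²(ω)` (`integral_mul_eq_zero_of_moments`). -/

namespace ThinBeam

/-! ### Test functions and weak derivatives on an interval -/

/-- Test functions of one variable: elements of `C₀^∞(a,b)`. -/
structure IsTestOn (a b : ℝ) (f : ℝ → ℝ) : Prop where
  smooth : ContDiff ℝ ∞ f
  compact : HasCompactSupport f
  support : tsupport f ⊆ Ioo a b

namespace IsTestOn

variable {a b : ℝ} {f g : ℝ → ℝ}

theorem continuous (hf : IsTestOn a b f) : Continuous f := hf.smooth.continuous

theorem integrable (hf : IsTestOn a b f) : Integrable f :=
  hf.continuous.integrable_of_hasCompactSupport hf.compact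

theorem differentiable (hf : IsTestOn a b f) : Differentiable ℝ f :=
  hf.smooth.differentiable (by simp)

theorem deriv (hf : IsTestOn a b f) : IsTestOn a b (deriv f) :=
  ⟨(contDiff_infty_iff_deriv.1 hf.smooth).2, hf.compact.deriv,
    (tsupport_deriv_subset).trans hf.support⟩

theorem sub (hf : IsTestOn a b f) (hg : IsTestOn a b g) : IsTestOn a b (fun x => f x - g x) :=
  ⟨hf.smooth.sub hg.smooth, hf.compact.sub hg.compact,
    (tsupport_sub f g).trans (union_subset hf.support hg.support)⟩

theorem const_mul (c : ℝ) (hf : IsTestOn a b f) : IsTestOn a b (fun x => c * f x) :=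
  ⟨contDiff_const.mul hf.smooth, hf.compact.mul_left,
    (closure_mono (Function.support_mul_subset_right _ _)).trans hf.support⟩

theorem mul_smooth (hf : IsTestOn a b f) (hg : ContDiff ℝ ∞ g) :
    IsTestOn a b (fun x => f x * g x) :=
  ⟨hf.smooth.mul hg, hf.compact.mul_right,
    (closure_mono (Function.support_mul_subset_left _ _)).trans hf.support⟩

theorem eq_zero (hf : IsTestOn a b f) {x : ℝ} (hx : x ∉ Ioo a b) : f x = 0 :=
  image_eq_zero_of_notMem_tsupport fun h => hx (hf.support h)

theorem bounded (hf : IsTestOn a b f) : ∃ C, ∀ x, ‖f x‖ ≤ C :=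
  hf.compact.exists_bound_of_continuous hf.continuous

theorem setIntegral_mul (hf : IsTestOn a b f) (F : ℝ → ℝ) :
    ∫ x in Ioo a b, f x * F x = ∫ x, f x * F x :=
  setIntegral_eq_integral_of_forall_compl_eq_zero fun x hx => by simp [hf.eq_zero hx]

theorem integrableOn_mul (hf : IsTestOn a b f) {S : Set ℝ} {F : ℝ → ℝ} (hF : IntegrableOn F S) :
    IntegrableOn (fun x => f x * F x) S := by
  obtain ⟨C, hC⟩ := hf.bounded
  exact Integrable.bdd_mul hF hf.continuous.aestronglyMeasurable (Eventually.of_forall hC)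

theorem integral_deriv (hf : IsTestOn a b f) : ∫ x, _root_.deriv f x = 0 :=
  integral_eq_zero_of_hasDerivAt_of_integrable (fun x => (hf.differentiable x).hasDerivAt)
    hf.deriv.integrable hf.integrable

theorem integral_id_mul_deriv (hf : IsTestOn a b f) :
    ∫ x, x * _root_.deriv f x = -∫ x, f x := by
  have h1 : IsTestOn a b (fun x => f x * x) := hf.mul_smooth contDiff_id
  have h2 : IsTestOn a b (fun x => _root_.deriv f x * x) := hf.deriv.mul_smooth contDiff_id
  have h3 := h1.integral_deriv
  have h4 : ∀ x, _root_.deriv (fun x => f x * x) x = _root_.deriv f x * x + f x := fun x => by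
    have := ((hf.differentiable x).hasDerivAt.mul (hasDerivAt_id x)).deriv
    simp only [mul_one, id] at this
    exact this
  simp_rw [h4] at h3
  rw [integral_add h2.integrable hf.integrable] at h3
  simp_rw [mul_comm _ (_root_.deriv f _)]
  linarith

/-- A test function with vanishing integral is the derivative of a test function. -/
theorem exists_primitive (hg : IsTestOn a b g) (h0 : ∫ x, g x = 0) :
    ∃ f, IsTestOn a b f ∧ _root_.deriv f = g := by
  -- The primitive is supported in the smallest interval `[c, d]` containing the support of `g`; an
  -- empty support has no extreme points and is treated apart.
  rcases (tsupport g).eq_empty_or_nonempty with he | hne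
  · refine ⟨g, hg, ?_⟩
    rw [tsupport_eq_empty_iff] at he
    subst he
    ext x
    simp
  obtain ⟨c, hc⟩ := hg.compact.isCompact.exists_isLeast hne
  obtain ⟨d, hd⟩ := hg.compact.isCompact.exists_isGreatest hne
  have hac := (hg.support hc.1).1
  have hdb := (hg.support hd.1).2
  have hz : ∀ x, x ∉ Icc c d → g x = 0 := fun x hx =>
    image_eq_zero_of_notMem_tsupport fun h => hx ⟨hc.2 h, hd.2 h⟩
  have hder : _root_.deriv (fun s => ∫ t in a..s, g t) = g := by
    ext s
    exact (hg.continuous.integral_hasStrictDerivAt a s).hasDerivAt.deriv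
  have hsupp : tsupport (fun s => ∫ t in a..s, g t) ⊆ Icc c d := by
    refine closure_minimal (fun s hs => ?_) isClosed_Icc
    by_contra hcd
    apply hs
    rw [mem_Icc, not_and_or, not_le, not_le] at hcd
    rcases hcd with h | h
    · refine intervalIntegral.integral_zero_ae (Eventually.of_forall fun x hx => hz x fun h' => ?_)
      rcases mem_uIoc.1 hx with h2 | h2 <;> linarith [h'.1]
    · show ∫ t in a..s, g t = 0
      rw [intervalIntegral.integral_eq_integral_of_support_subset, h0]
      intro x hx
      have := hg.support (subset_tsupport _ hx)
      exact ⟨this.1, by have := hd.2 (subset_tsupport _ hx); linarith⟩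
  refine ⟨_, ⟨?_, isCompact_Icc.of_isClosed_subset (isClosed_tsupport _) hsupp, ?_⟩, hder⟩
  · refine contDiff_infty_iff_deriv.2 ⟨fun s => ?_, ?_⟩
    · exact (hg.continuous.integral_hasStrictDerivAt a s).hasDerivAt.differentiableAt
    · rw [hder]; exact hg.smooth
  · exact hsupp.trans fun x hx => ⟨hac.trans_le hx.1, hx.2.trans_lt hdb⟩

end IsTestOn

theorem exists_isTestOn_integral_eq_one {a b : ℝ} (hab : a < b) :
    ∃ ρ, IsTestOn a b ρ ∧ ∫ x, ρ x = 1 := by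
  let B : ContDiffBump ((a + b) / 2) := ⟨(b - a) / 8, (b - a) / 4, by linarith, by linarith⟩
  refine ⟨B.normed volume, ⟨B.contDiff_normed, B.hasCompactSupport_normed, ?_⟩, B.integral_normed⟩
  rw [B.tsupport_normed_eq, Real.closedBall_eq_Icc]
  intro x hx
  have h1 := hx.1
  have h2 := hx.2
  constructor <;> simp only [B] at h1 h2 <;> linarith

/-- Up to a combination of `ρ` and `ρ'`, every test function is a second derivative of
a test function. -/
theorem exists_second_primitive {a b : ℝ} {ρ g : ℝ → ℝ} (hρ : IsTestOn a b ρ)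
    (h1 : ∫ x, ρ x = 1) (hg : IsTestOn a b g) :
    ∃ f, IsTestOn a b f ∧ ∀ x, deriv (deriv f) x =
      g x - (∫ y, g y) * ρ x - ((∫ y, y * ρ y) * (∫ y, g y) - ∫ y, y * g y) * deriv ρ x := by
  have hg' := hg.sub (hρ.const_mul (∫ y, g y))
  obtain ⟨f, hf, hfd⟩ := hg'.exists_primitive (by
    rw [integral_sub hg.integrable (hρ.integrable.const_mul _), integral_const_mul, h1]; ring)
  -- The first primitive `f` need not have mean zero, hence the second correction by `ρ`.
  -- Integrating `x f'(x)` by parts expresses `∫ f` through the moments of `g` and `ρ`.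
  have hf' := hf.sub (hρ.const_mul (∫ y, f y))
  obtain ⟨F, hF, hFd⟩ := hf'.exists_primitive (by
    rw [integral_sub hf.integrable (hρ.integrable.const_mul _), integral_const_mul, h1]; ring)
  have key := hf.integral_id_mul_deriv
  rw [hfd] at key
  have e : ∀ x, x * (g x - (∫ y, g y) * ρ x) = g x * x - (∫ y, g y) * (ρ x * x) := fun x => by ring
  simp_rw [e] at key
  have i1 : Integrable (fun x => g x * x) := (hg.mul_smooth contDiff_id).integrable
  have i2 : Integrable (fun x => ρ x * x) := (hρ.mul_smooth contDiff_id).integrable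
  rw [integral_sub i1 (i2.const_mul _), integral_const_mul] at key
  refine ⟨F, hF, fun x => ?_⟩
  have h2 : (∫ y, y * ρ y) * (∫ y, g y) - ∫ y, y * g y = ∫ y, f y := by
    simp_rw [fun y => mul_comm y (ρ y), fun y => mul_comm y (g y)]
    linarith
  rw [h2, hFd]
  have := ((hf.differentiable x).hasDerivAt.sub
    ((hρ.differentiable x).hasDerivAt.const_mul (∫ y, f y))).deriv
  rw [hfd] at this
  exact this

/-- The fundamental lemma of the calculus of variations on an interval. -/
theorem ae_eq_zero_of_forall_isTestOn {a b : ℝ} {F : ℝ → ℝ} (hF : IntegrableOn F (Ioo a b))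
    (h : ∀ f, IsTestOn a b f → ∫ x in Ioo a b, f x * F x = 0) :
    ∀ᵐ x ∂(volume.restrict (Ioo a b)), F x = 0 := by
  rw [ae_restrict_iff' measurableSet_Ioo]
  refine isOpen_Ioo.ae_eq_zero_of_integral_contDiff_smul_eq_zero hF.locallyIntegrableOn ?_
  intro g hg hc hs
  have ht : IsTestOn a b g := ⟨hg, hc, hs⟩
  simpa [ht.setIntegral_mul] using h g ht

/-- Dual form of `exists_second_primitive`: pairing `F` with the decomposition of a test function
`g` gives `∫ g F = ∫ g (A + (X - x) B)`, where `A = ∫ ρ F`, `B = ∫ ρ' F` and `X = ∫ y ρ(y) dy`. -/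
theorem ae_eq_affine_of_forall_isTestOn {a b : ℝ} (hab : a < b) {F : ℝ → ℝ}
    (hF : IntegrableOn F (Ioo a b))
    (h : ∀ f, IsTestOn a b f → ∫ x in Ioo a b, deriv (deriv f) x * F x = 0) :
    ∃ c d : ℝ, ∀ᵐ x ∂(volume.restrict (Ioo a b)), F x = c + d * x := by
  obtain ⟨ρ, hρ, h1⟩ := exists_isTestOn_integral_eq_one hab
  set A := ∫ x in Ioo a b, ρ x * F x
  set B := ∫ x in Ioo a b, deriv ρ x * F x
  set X := ∫ y, y * ρ y
  have := ae_eq_zero_of_forall_isTestOn (F := fun x => F x - (A + (X - x) * B)) (a := a) (b := b)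
    ?_ ?_
  · exact ⟨A + X * B, -B, this.mono fun x hx => by linarith⟩
  · refine hF.sub (Continuous.integrableOn_Icc (a := a) (b := b) ?_ |>.mono_set Ioo_subset_Icc_self)
    fun_prop
  · intro g hg
    obtain ⟨f, hf, hfd⟩ := exists_second_primitive hρ h1 hg
    have i1 := hg.integrableOn_mul hF
    have i2 := (hρ.integrableOn_mul hF).const_mul (∫ y, g y)
    have i3 := (hρ.deriv.integrableOn_mul hF).const_mul (X * (∫ y, g y) - ∫ y, y * g y)
    have h3 : ∀ x, deriv (deriv f) x * F x = g x * F x - (∫ y, g y) * (ρ x * F x)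
      - (X * (∫ y, g y) - ∫ y, y * g y) * (deriv ρ x * F x) := fun x => by rw [hfd]; ring
    have h2 := h f hf
    simp_rw [h3] at h2
    have i12 : Integrable (fun x => g x * F x - (∫ y, g y) * (ρ x * F x))
      (volume.restrict (Ioo a b)) := i1.sub i2
    rw [integral_sub i12 i3, integral_sub i1 i2, integral_const_mul,
      integral_const_mul] at h2
    have h4 : ∀ x, g x * (F x - (A + (X - x) * B)) =
      g x * F x - (A + X * B) * (g x * 1) + B * (g x * x) := fun x => by ring
    have j2 : IntegrableOn (fun x => (A + X * B) * (g x * 1)) (Ioo a b) := by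
      simp_rw [mul_one]; exact hg.integrable.integrableOn.const_mul (A + X * B)
    have j3 : IntegrableOn (fun x => B * (g x * x)) (Ioo a b) :=
      (hg.mul_smooth contDiff_id).integrable.integrableOn.const_mul B
    simp_rw [h4]
    have j12 : Integrable (fun x => g x * F x - (A + X * B) * (g x * 1))
      (volume.restrict (Ioo a b)) := i1.sub j2
    rw [integral_add j12 j3, integral_sub i1 j2, integral_const_mul, integral_const_mul,
      hg.setIntegral_mul (fun x => 1), hg.setIntegral_mul (fun x => x)]
    simp_rw [mul_one, mul_comm (g _)]
    simp_rw [mul_comm (g _)] at h2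
    change _ - _ * A - _ * B = 0 at h2
    linarith

theorem ae_eq_const_of_forall_isTestOn {a b : ℝ} (hab : a < b) {F : ℝ → ℝ}
    (hF : IntegrableOn F (Ioo a b))
    (h : ∀ f, IsTestOn a b f → ∫ x in Ioo a b, deriv f x * F x = 0) :
    ∃ c : ℝ, ∀ᵐ x ∂(volume.restrict (Ioo a b)), F x = c := by
  obtain ⟨ρ, hρ, h1⟩ := exists_isTestOn_integral_eq_one hab
  set A := ∫ x in Ioo a b, ρ x * F x
  have := ae_eq_zero_of_forall_isTestOn (F := fun x => F x - A) (a := a) (b := b) ?_ ?_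
  · exact ⟨A, this.mono fun x hx => by linarith⟩
  · exact hF.sub (integrableOn_const (by simp))
  · intro g hg
    obtain ⟨f, hf, hfd⟩ := (hg.sub (hρ.const_mul (∫ y, g y))).exists_primitive (by
      rw [integral_sub hg.integrable (hρ.integrable.const_mul _), integral_const_mul, h1]; ring)
    have i1 := hg.integrableOn_mul hF
    have i2 := (hρ.integrableOn_mul hF).const_mul (∫ y, g y)
    have h3 : ∀ x, deriv f x * F x = g x * F x - (∫ y, g y) * (ρ x * F x) := fun x => by
      rw [hfd]; ring
    have h2 := h f hf
    simp_rw [h3] at h2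
    rw [integral_sub i1 i2, integral_const_mul] at h2
    have h4 : ∀ x, g x * (F x - A) = g x * F x - A * (g x * 1) := fun x => by ring
    have j2 : IntegrableOn (fun x => A * (g x * 1)) (Ioo a b) := by
      simp_rw [mul_one]; exact hg.integrable.integrableOn.const_mul A
    simp_rw [h4]
    rw [integral_sub i1 j2, integral_const_mul, hg.setIntegral_mul (fun x => 1)]
    simp_rw [mul_one]
    change _ - _ * A = 0 at h2
    linarith

/-- Integration by parts for primitives of integrable functions. -/
theorem integral_mul_add_mul_of_primitive {a b : ℝ} (hab : a ≤ b) {p q P Q : ℝ → ℝ}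
    (hp : IntervalIntegrable p volume a b) (hq : IntervalIntegrable q volume a b)
    (hP : ∀ s ∈ Icc a b, P s = P a + ∫ t in a..s, p t)
    (hQ : ∀ s ∈ Icc a b, Q s = Q a + ∫ t in a..s, q t) :
    ∫ s in a..b, (p s * Q s + P s * q s) = P b * Q b - P a * Q a := by
  have key : ∀ {r R : ℝ → ℝ}, IntervalIntegrable r volume a b →
      AbsolutelyContinuousOnInterval (fun s => R a + ∫ t in a..s, r t) a b ∧
      ∀ᵐ x, x ∈ uIcc a b → deriv (fun s => R a + ∫ t in a..s, r t) x = r x := by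
    intro r R hr
    constructor
    · have h1 := hr.absolutelyContinuousOnInterval_intervalIntegral (c := a) left_mem_uIcc
      have h2 : AbsolutelyContinuousOnInterval (fun _ : ℝ => R a) a b :=
        (LipschitzWith.const (R a) : LipschitzWith 0 _).lipschitzOnWith.absolutelyContinuousOnInterval
      exact h2.add h1
    · filter_upwards [hr.ae_hasDerivAt_integral] with x hx hxm
      exact ((hx hxm a left_mem_uIcc).const_add _).deriv
  obtain ⟨acP, dP⟩ := key (R := P) hp
  obtain ⟨acQ, dQ⟩ := key (R := Q) hq
  have h := AbsolutelyContinuousOnInterval.integral_deriv_mul_eq_sub acP acQ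
  simp only [intervalIntegral.integral_same, add_zero] at h
  rw [← hP b (right_mem_Icc.2 hab), ← hQ b (right_mem_Icc.2 hab)] at h
  rw [← h]
  refine intervalIntegral.integral_congr_ae ?_
  filter_upwards [dP, dQ] with x h1 h2 hx
  have hx' : x ∈ uIcc a b := uIoc_subset_uIcc hx
  have hx2 : x ∈ Icc a b := by rwa [uIcc_of_le hab] at hx'
  rw [h1 hx', h2 hx', hP x hx2, hQ x hx2]

/-- A function with an integrable weak derivative has an absolutely continuous representative. -/
theorem ae_eq_add_primitive_of_weak_deriv {a b : ℝ} (hab : a < b) {F G : ℝ → ℝ}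
    (hF : IntegrableOn F (Ioo a b)) (hG : IntegrableOn G (Ioo a b))
    (h : ∀ f, IsTestOn a b f →
      ∫ x in Ioo a b, deriv f x * F x = -∫ x in Ioo a b, f x * G x) :
    ∃ c : ℝ, ∀ᵐ x ∂(volume.restrict (Ioo a b)), F x = c + ∫ t in a..x, G t := by
  have hG' : IntervalIntegrable G volume a b := by
    rw [intervalIntegrable_iff_integrableOn_Ioo_of_le hab.le]; exact hG
  have hc : ContinuousOn (fun x => ∫ t in a..x, G t) (Icc a b) :=
    intervalIntegral.continuousOn_primitive_interval
      (by rw [uIcc_of_le hab.le]; exact (integrableOn_Icc_iff_integrableOn_Ioo).2 hG) |>.mono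
      (by rw [uIcc_of_le hab.le])
  have hi : IntegrableOn (fun x => ∫ t in a..x, G t) (Ioo a b) :=
    (hc.integrableOn_Icc).mono_set Ioo_subset_Icc_self
  have hFi : IntegrableOn (fun x => F x - ∫ t in a..x, G t) (Ioo a b) := hF.sub hi
  suffices H : ∀ f, IsTestOn a b f →
      ∫ x in Ioo a b, deriv f x * (F x - ∫ t in a..x, G t) = 0 by
    obtain ⟨c, hc⟩ := ae_eq_const_of_forall_isTestOn hab hFi H
    exact ⟨c, hc.mono fun x hx => by linarith⟩
  intro f hf
  have hfp : ∀ s ∈ Icc a b, f s = f a + ∫ t in a..s, deriv f t := fun s _ => by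
    rw [intervalIntegral.integral_deriv_eq_sub (fun x _ => hf.differentiable x)
      (hf.deriv.continuous.intervalIntegrable _ _)]
    ring
  have h1 := integral_mul_add_mul_of_primitive hab.le (q := G) (Q := fun x => ∫ t in a..x, G t)
    (hf.deriv.continuous.intervalIntegrable _ _) hG' hfp (fun s _ => by simp)
  have i1 := hf.deriv.integrableOn_mul hF
  have i2 := hf.deriv.integrableOn_mul hi
  have i3 := hf.integrableOn_mul hG
  rw [intervalIntegral.integral_of_le hab.le, integral_Ioc_eq_integral_Ioo,
    integral_add i2 i3, hf.eq_zero (x := a) (by simp), hf.eq_zero (x := b) (by simp)] at h1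
  simp_rw [mul_sub]
  rw [integral_sub i1 i2, h f hf]
  linarith

end ThinBeam

/-! ### The one-dimensional problem along the curve -/

namespace ThinBeam

theorem hasDerivAt_primitive_of_continuousOn {G : ℝ → ℝ} (hG : ContinuousOn G (Icc 0 1)) (c : ℝ)
    {s : ℝ} (hs : s ∈ Ioo (0 : ℝ) 1) : HasDerivAt (fun x => c + ∫ t in (0 : ℝ)..x, G t) (G s) s := by
  refine (intervalIntegral.integral_hasDerivAt_right ?_ ?_ ?_).const_add c
  · refine (hG.mono ?_).intervalIntegrable
    rw [uIcc_of_le hs.1.le]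
    exact Icc_subset_Icc_right hs.2.le
  · exact (hG.mono Ioo_subset_Icc_self).stronglyMeasurableAtFilter isOpen_Ioo s hs
  · exact hG.continuousAt (Icc_mem_nhds hs.1 hs.2)

theorem continuousOn_primitive_Icc {G : ℝ → ℝ} (hG : IntegrableOn G (Ioo 0 1)) (c : ℝ) :
    ContinuousOn (fun x => c + ∫ t in (0 : ℝ)..x, G t) (Icc 0 1) := by
  have h := intervalIntegral.continuousOn_primitive_interval (μ := volume) (f := G) (a := 0) (b := 1)
    (by rw [uIcc_of_le zero_le_one]; exact (integrableOn_Icc_iff_integrableOn_Ioo).2 hG)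
  rw [uIcc_of_le zero_le_one] at h
  exact continuousOn_const.add h

theorem intervalIntegrable_of_integrableOn_Ioo {G : ℝ → ℝ} (hG : IntegrableOn G (Ioo 0 1)) {s t : ℝ}
    (hs : s ∈ Icc (0 : ℝ) 1) (ht : t ∈ Icc (0 : ℝ) 1) : IntervalIntegrable G volume s t := by
  have h : IntervalIntegrable G volume 0 1 := by
    rw [intervalIntegrable_iff_integrableOn_Ioo_of_le zero_le_one]; exact hG
  exact h.mono_set (by rw [uIcc_of_le zero_le_one]; exact uIcc_subset_Icc hs ht)

/-- A one-dimensional field `(v₁, v₂)` with `v' = θ n`, `θ' = b` and `v · τ = 0` is of the form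
`W n` where `W'' = b` and `W` vanishes wherever the curvature `κ` does not. -/
theorem exists_normal_component {t1 t2 κ v1 v2 θ b : ℝ → ℝ}
    (ht1 : ContinuousOn t1 (Icc 0 1)) (ht2 : ContinuousOn t2 (Icc 0 1))
    (d1 : ∀ s ∈ Ioo (0 : ℝ) 1, HasDerivAt t1 (-(κ s * t2 s)) s)
    (d2 : ∀ s ∈ Ioo (0 : ℝ) 1, HasDerivAt t2 (κ s * t1 s) s)
    (hn : ∀ s ∈ Icc (0 : ℝ) 1, t1 s ^ 2 + t2 s ^ 2 = 1)
    (iv1 : IntegrableOn v1 (Ioo 0 1)) (iv2 : IntegrableOn v2 (Ioo 0 1))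
    (iθ : IntegrableOn θ (Ioo 0 1)) (ib : IntegrableOn b (Ioo 0 1))
    (hv1 : ∀ η, IsTestOn 0 1 η →
      ∫ s in Ioo 0 1, deriv η s * v1 s = -∫ s in Ioo 0 1, η s * -(θ s * t2 s))
    (hv2 : ∀ η, IsTestOn 0 1 η →
      ∫ s in Ioo 0 1, deriv η s * v2 s = -∫ s in Ioo 0 1, η s * (θ s * t1 s))
    (hθ : ∀ η, IsTestOn 0 1 η →
      ∫ s in Ioo 0 1, deriv η s * θ s = -∫ s in Ioo 0 1, η s * b s)
    (hτ : ∀ η, IsTestOn 0 1 η → ∫ s in Ioo 0 1, η s * (v1 s * t1 s + v2 s * t2 s) = 0) :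
    ∃ Θ W : ℝ → ℝ, ContinuousOn Θ (Icc 0 1) ∧ ContinuousOn W (Icc 0 1) ∧
      (∀ s ∈ Icc (0 : ℝ) 1, Θ s = Θ 0 + ∫ t in (0 : ℝ)..s, b t) ∧
      (∀ s ∈ Ioo (0 : ℝ) 1, HasDerivAt W (Θ s) s) ∧
      ∀ s ∈ Ioo (0 : ℝ) 1, κ s * W s = 0 := by
  obtain ⟨c, hc⟩ := ae_eq_add_primitive_of_weak_deriv zero_lt_one iθ ib hθ
  set Θ : ℝ → ℝ := fun s => c + ∫ t in (0 : ℝ)..s, b t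
  have cΘ : ContinuousOn Θ (Icc 0 1) := continuousOn_primitive_Icc ib c
  have cG1 : ContinuousOn (fun s => -(Θ s * t2 s)) (Icc 0 1) := (cΘ.mul ht2).neg
  have cG2 : ContinuousOn (fun s => Θ s * t1 s) (Icc 0 1) := cΘ.mul ht1
  have iG1 : IntegrableOn (fun s => -(Θ s * t2 s)) (Ioo 0 1) :=
    cG1.integrableOn_Icc.mono_set Ioo_subset_Icc_self
  have iG2 : IntegrableOn (fun s => Θ s * t1 s) (Ioo 0 1) :=
    cG2.integrableOn_Icc.mono_set Ioo_subset_Icc_self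
  obtain ⟨c1, hc1⟩ := ae_eq_add_primitive_of_weak_deriv zero_lt_one iv1 iG1 (fun η hη => by
    rw [hv1 η hη]
    congr 1
    refine integral_congr_ae ?_
    filter_upwards [hc] with s hs
    rw [hs])
  obtain ⟨c2, hc2⟩ := ae_eq_add_primitive_of_weak_deriv zero_lt_one iv2 iG2 (fun η hη => by
    rw [hv2 η hη]
    congr 1
    refine integral_congr_ae ?_
    filter_upwards [hc] with s hs
    rw [hs])
  set V1 : ℝ → ℝ := fun s => c1 + ∫ t in (0 : ℝ)..s, -(Θ t * t2 t)
  set V2 : ℝ → ℝ := fun s => c2 + ∫ t in (0 : ℝ)..s, Θ t * t1 t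
  have cV1 : ContinuousOn V1 (Icc 0 1) := continuousOn_primitive_Icc iG1 c1
  have cV2 : ContinuousOn V2 (Icc 0 1) := continuousOn_primitive_Icc iG2 c2
  have dV1 : ∀ s ∈ Ioo (0 : ℝ) 1, HasDerivAt V1 (-(Θ s * t2 s)) s := fun s hs =>
    hasDerivAt_primitive_of_continuousOn cG1 c1 hs
  have dV2 : ∀ s ∈ Ioo (0 : ℝ) 1, HasDerivAt V2 (Θ s * t1 s) s := fun s hs =>
    hasDerivAt_primitive_of_continuousOn cG2 c2 hs
  have cZ : ContinuousOn (fun s => V1 s * t1 s + V2 s * t2 s) (Icc 0 1) :=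
    (cV1.mul ht1).add (cV2.mul ht2)
  have hz : ∀ᵐ s ∂(volume.restrict (Ioo (0 : ℝ) 1)), V1 s * t1 s + V2 s * t2 s = 0 := by
    refine ae_eq_zero_of_forall_isTestOn (cZ.integrableOn_Icc.mono_set Ioo_subset_Icc_self) ?_
    intro η hη
    refine (integral_congr_ae ?_).trans (hτ η hη)
    filter_upwards [hc1, hc2] with s h1 h2
    rw [h1, h2]
  -- Continuity upgrades `V · τ = 0` from almost everywhere to everywhere, so that it can be
  -- differentiated below.
  have hZ : ∀ s ∈ Ioo (0 : ℝ) 1, V1 s * t1 s + V2 s * t2 s = 0 :=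
    Measure.eqOn_open_of_ae_eq (f := fun s => V1 s * t1 s + V2 s * t2 s) (g := fun _ => 0) hz
      isOpen_Ioo (cZ.mono Ioo_subset_Icc_self) continuousOn_const
  refine ⟨Θ, fun s => V2 s * t1 s - V1 s * t2 s, cΘ, (cV2.mul ht1).sub (cV1.mul ht2),
    fun s _ => by simp [Θ], fun s hs => ?_, fun s hs => ?_⟩
  -- With `W = V · n`, the product rule gives `W' = Θ |τ|² - κ V · τ = Θ`.
  · have h := ((dV2 s hs).mul (d1 s hs)).sub ((dV1 s hs).mul (d2 s hs))
    refine h.congr_deriv ?_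
    have e1 := hn s (Ioo_subset_Icc_self hs)
    have e2 := hZ s hs
    linear_combination Θ s * e1 - κ s * e2
  -- Differentiating `V · τ = 0` leaves only `κ W`, because `V' = Θ n` is orthogonal to `τ`.
  · have h := ((dV1 s hs).mul (d1 s hs)).add ((dV2 s hs).mul (d2 s hs))
    have h0 : HasDerivAt (V1 * t1 + V2 * t2) 0 s :=
      (hasDerivAt_const s (0 : ℝ)).congr_of_eventuallyEq
        (by filter_upwards [isOpen_Ioo.mem_nhds hs] with x hx using hZ x hx)
    have := h.unique h0
    linear_combination this

theorem affine_eq_of_ae_eq {a b : ℝ} (hab : a < b) {F : ℝ → ℝ} {α β α' β' : ℝ}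
    (h : ∀ᵐ x ∂(volume.restrict (Ioo a b)), F x = α + β * x)
    (h' : ∀ᵐ x ∂(volume.restrict (Ioo a b)), F x = α' + β' * x) : α = α' ∧ β = β' := by
  have hE : EqOn (fun x : ℝ => α + β * x) (fun x => α' + β' * x) (Ioo a b) := by
    refine Measure.eqOn_open_of_ae_eq (μ := volume) ?_ isOpen_Ioo (by fun_prop) (by fun_prop)
    filter_upwards [h, h'] with x h1 h2
    rw [← h1, ← h2]
  have e1 := hE (x := a + (b - a) / 3) ⟨by linarith, by linarith⟩
  have e2 := hE (x := a + (b - a) / 2) ⟨by linarith, by linarith⟩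
  simp only at e1 e2
  have e3 : (β - β') * (b - a) = 0 := by linarith
  have e4 : β = β' := by
    rcases mul_eq_zero.1 e3 with h | h <;> linarith
  subst e4
  exact ⟨by linarith, rfl⟩

/-- If `h` annihilates the second derivatives of all smooth functions vanishing where `κ` does
not, then it annihilates every `b = W''` with `κ W = 0`. -/
theorem integral_mul_eq_zero_of_annihilates {κ h b Θ W : ℝ → ℝ}
    (hκ : ContinuousOn κ (Icc 0 1)) {m : ℕ} {p : Fin (m + 1) → ℝ} (hp : StrictMono p)
    (hp0 : p 0 = 0) (hp1 : p (Fin.last m) = 1)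
    (hk : ∀ i : Fin m, (∀ s ∈ Ioo (p i.castSucc) (p i.succ), κ s ≠ 0) ∨
      (∀ s ∈ Ioo (p i.castSucc) (p i.succ), κ s = 0))
    (ih : IntegrableOn h (Ioo 0 1)) (ib : IntegrableOn b (Ioo 0 1))
    (ihb : IntegrableOn (fun s => h s * b s) (Ioo 0 1))
    (cΘ : ContinuousOn Θ (Icc 0 1)) (cW : ContinuousOn W (Icc 0 1))
    (hΘ : ∀ s ∈ Icc (0 : ℝ) 1, Θ s = Θ 0 + ∫ t in (0 : ℝ)..s, b t)
    (dW : ∀ s ∈ Ioo (0 : ℝ) 1, HasDerivAt W (Θ s) s)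
    (hW : ∀ s ∈ Ioo (0 : ℝ) 1, κ s * W s = 0)
    (hh : ∀ f : ℝ → ℝ, ContDiff ℝ ∞ f → HasCompactSupport f → (∀ s ∈ Ioo (0 : ℝ) 1, f s * κ s = 0) →
      ∫ s in Ioo 0 1, deriv (deriv f) s * h s = 0) :
    ∫ s in Ioo 0 1, h s * b s = 0 := by
  set H : ℝ → ℝ := (Ioo (0 : ℝ) 1).indicator h with hH
  have iH : Integrable H := ih.integrable_indicator measurableSet_Ioo
  -- Test functions on `(a, c)` are admissible in `hh` as soon as `κ` vanishes on `(a, c) ∩ (0, 1)`.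
  -- The interval may stick out of `(0, 1)`, and there `H` is zero; this encodes the free ends.
  have haff : ∀ a c : ℝ, a < c → (∀ s ∈ Ioo a c, s ∈ Ioo (0 : ℝ) 1 → κ s = 0) →
      ∃ α β : ℝ, ∀ᵐ x ∂(volume.restrict (Ioo a c)), H x = α + β * x := by
    intro a c hac hz
    refine ae_eq_affine_of_forall_isTestOn hac iH.integrableOn fun f hf => ?_
    rw [hf.deriv.deriv.setIntegral_mul, ← hh f hf.smooth hf.compact, ← integral_indicator
      measurableSet_Ioo]
    · congr 1 with x
      by_cases hx : x ∈ Ioo (0 : ℝ) 1 <;> simp [hH, hx]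
    · intro s hs
      by_cases hsc : s ∈ Ioo a c
      · rw [hz s hsc hs, mul_zero]
      · rw [hf.eq_zero hsc, zero_mul]
  have hΘ' : ∀ t ∈ Icc (0 : ℝ) 1, ∀ s ∈ Icc (0 : ℝ) 1, Θ s = Θ t + ∫ x in t..s, b x := by
    intro t ht s hs
    have h0 : (0 : ℝ) ∈ Icc (0 : ℝ) 1 := by simp
    rw [hΘ t ht, hΘ s hs, add_assoc, intervalIntegral.integral_add_adjacent_intervals
      (intervalIntegrable_of_integrableOn_Ioo ib h0 ht)
      (intervalIntegrable_of_integrableOn_Ioo ib ht hs)]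
  have hW' : ∀ t ∈ Icc (0 : ℝ) 1, ∀ s ∈ Icc (0 : ℝ) 1, t ≤ s → ∫ x in t..s, Θ x = W s - W t := by
    intro t ht s hs hts
    refine intervalIntegral.integral_eq_sub_of_hasDerivAt_of_le hts
      (cW.mono (Icc_subset_Icc ht.1 hs.2)) (fun x hx => dW x ⟨ht.1.trans_lt hx.1, hx.2.trans_le hs.2⟩)
      ((cΘ.mono ?_).intervalIntegrable)
    rw [uIcc_of_le hts]
    exact Icc_subset_Icc ht.1 hs.2
  -- integration by parts against an affine function
  have hibp : ∀ t ∈ Icc (0 : ℝ) 1, ∀ s ∈ Icc (0 : ℝ) 1, t < s → ∀ α β : ℝ,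
      (∀ᵐ x ∂(volume.restrict (Ioo t s)), H x = α + β * x) →
      ∫ x in t..s, h x * b x =
        ((α + β * s) * Θ s - β * W s) - ((α + β * t) * Θ t - β * W t) := by
    intro t ht s hs hts α β hae
    have i1 := intervalIntegrable_of_integrableOn_Ioo ib ht hs
    have i2 : IntervalIntegrable Θ volume t s :=
      (cΘ.mono (uIcc_subset_Icc ht hs)).intervalIntegrable
    have h1 := integral_mul_add_mul_of_primitive hts.le (p := fun _ => β) (P := fun x => α + β * x)
      (q := b) (Q := Θ) (by simp) i1 (fun x _ => by simp; ring)
      (fun x hx => hΘ' t ht x ⟨ht.1.trans hx.1, hx.2.trans hs.2⟩)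
    rw [intervalIntegral.integral_add (i2.const_mul β)
      (i1.continuousOn_mul (by fun_prop)), intervalIntegral.integral_const_mul,
      hW' t ht s hs hts.le] at h1
    have h2 : ∫ x in t..s, h x * b x = ∫ x in t..s, (α + β * x) * b x := by
      rw [intervalIntegral.integral_of_le hts.le, intervalIntegral.integral_of_le hts.le,
        integral_Ioc_eq_integral_Ioo, integral_Ioc_eq_integral_Ioo]
      refine integral_congr_ae ?_
      filter_upwards [hae, ae_restrict_mem measurableSet_Ioo] with x hx hxm
      rw [← hx, hH, indicator_of_mem]
      exact ⟨ht.1.trans_lt hxm.1, hxm.2.trans_le hs.2⟩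
    rw [h2]
    linarith
  -- induction over the partition
  let Inv : ℝ → Prop := fun t => ∃ α β : ℝ,
    ∫ x in (0 : ℝ)..t, h x * b x = (α + β * t) * Θ t - β * W t ∧
    ((W t = 0 ∧ Θ t = 0) ∨ ∃ a < t, (∀ s ∈ Ioo a t, s ∈ Ioo (0 : ℝ) 1 → κ s = 0) ∧
      ∀ᵐ x ∂(volume.restrict (Ioo a t)), H x = α + β * x)
  -- `Inv t` says that the integral up to `t` equals the boundary term at `t`, and that either this
  -- term vanishes through `W` and `Θ`, or `α + β x` is the value of `H` just left of `t`. At `0`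
  -- the second case holds with zero coefficients, `H` being zero on `(-1, 0)`.
  have inv0 : Inv 0 := by
    refine ⟨0, 0, by simp, Or.inr ⟨-1, by norm_num, fun s hs hs' => absurd hs.2 (not_lt.2 hs'.1.le), ?_⟩⟩
    filter_upwards [ae_restrict_mem measurableSet_Ioo] with x hx
    rw [hH, indicator_of_notMem (fun hx' => absurd hx.2 (not_lt.2 hx'.1.le))]
    simp
  have h0I : (0 : ℝ) ∈ Icc (0 : ℝ) 1 := by simp
  have split : ∀ t ∈ Icc (0 : ℝ) 1, ∀ s ∈ Icc (0 : ℝ) 1, ∫ x in (0 : ℝ)..s, h x * b x =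
      (∫ x in (0 : ℝ)..t, h x * b x) + ∫ x in t..s, h x * b x := fun t ht s hs =>
    (intervalIntegral.integral_add_adjacent_intervals
      (intervalIntegrable_of_integrableOn_Ioo ihb h0I ht)
      (intervalIntegrable_of_integrableOn_Ioo ihb ht hs)).symm
  -- On a curved interval `W` vanishes, hence so does `Θ`, by continuity up to both ends. The
  -- boundary term carried from `t` is therefore zero.
  have stepN : ∀ t ∈ Icc (0 : ℝ) 1, ∀ s ∈ Icc (0 : ℝ) 1, t < s → (∀ x ∈ Ioo t s, κ x ≠ 0) →
      Inv t → Inv s := by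
    intro t ht s hs hts hne ⟨α, β, hI, _⟩
    have hsub : Ioo t s ⊆ Ioo 0 1 := Ioo_subset_Ioo ht.1 hs.2
    have hsub' : Icc t s ⊆ Icc 0 1 := Icc_subset_Icc ht.1 hs.2
    have hcl : closure (Ioo t s) = Icc t s := closure_Ioo hts.ne
    have W0 : ∀ x ∈ Ioo t s, W x = 0 := fun x hx =>
      (mul_eq_zero.1 (hW x (hsub hx))).resolve_left (hne x hx)
    have Θ0 : ∀ x ∈ Ioo t s, Θ x = 0 := fun x hx =>
      (dW x (hsub hx)).unique ((hasDerivAt_const x (0 : ℝ)).congr_of_eventuallyEq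
        (by filter_upwards [isOpen_Ioo.mem_nhds hx] with y hy using W0 y hy))
    have W0' : EqOn W (fun _ => 0) (Icc t s) :=
      EqOn.of_subset_closure W0 (cW.mono hsub') continuousOn_const Ioo_subset_Icc_self hcl.ge
    have Θ0' : EqOn Θ (fun _ => 0) (Icc t s) :=
      EqOn.of_subset_closure Θ0 (cΘ.mono hsub') continuousOn_const Ioo_subset_Icc_self hcl.ge
    have htm : t ∈ Icc t s := left_mem_Icc.2 hts.le
    have hsm : s ∈ Icc t s := right_mem_Icc.2 hts.le
    -- By Lebesgue differentiation `b = 0` almost everywhere where its primitive is constant.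
    have hb0 : ∫ x in t..s, h x * b x = 0 := by
      refine intervalIntegral.integral_zero_ae ?_
      filter_upwards [(intervalIntegrable_of_integrableOn_Ioo ib ht hs).ae_hasDerivAt_integral,
        Measure.ae_ne volume s] with x hx hxs hxm
      rw [uIoc_of_le hts.le] at hxm
      have hxI : x ∈ Ioo t s := ⟨hxm.1, lt_of_le_of_ne hxm.2 hxs⟩
      have hd := hx (by rw [uIcc_of_le hts.le]; exact Ioo_subset_Icc_self hxI) t left_mem_uIcc
      have hd0 : HasDerivAt (fun y => ∫ z in t..y, b z) 0 x :=
        (hasDerivAt_const x (0 : ℝ)).congr_of_eventuallyEq (by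
          filter_upwards [isOpen_Ioo.mem_nhds hxI] with y hy
          have := hΘ' t ht y (hsub' (Ioo_subset_Icc_self hy))
          rw [Θ0 y hy, Θ0' htm] at this
          linarith)
      rw [hd.unique hd0, mul_zero]
    refine ⟨0, 0, ?_, Or.inl ⟨W0' hsm, Θ0' hsm⟩⟩
    rw [split t ht s hs, hI, hb0, W0' htm, Θ0' htm]
    simp
  -- On a flat interval `H` is affine. After a vanishing boundary term its coefficients are
  -- arbitrary; after another flat interval they must agree with the previous ones for the boundary
  -- terms to cancel.
  have stepZ : ∀ t ∈ Icc (0 : ℝ) 1, ∀ s ∈ Icc (0 : ℝ) 1, t < s → (∀ x ∈ Ioo t s, κ x = 0) →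
      Inv t → Inv s := by
    intro t ht s hs hts hz ⟨α, β, hI, hcase⟩
    rcases hcase with ⟨hW0, hΘ0⟩ | ⟨a, hat, hza, hae⟩
    · obtain ⟨α', β', hae⟩ := haff t s hts (fun x hx _ => hz x hx)
      refine ⟨α', β', ?_, Or.inr ⟨t, hts, fun x hx _ => hz x hx, hae⟩⟩
      rw [split t ht s hs, hI, hibp t ht s hs hts α' β' hae, hW0, hΘ0]
      ring
    -- Continuity gives `κ = 0` at the junction too, so `H` is affine across it and its coefficients
    -- do not jump.
    · have hzt : κ t = 0 := by
        have : EqOn κ (fun _ => 0) (Icc t s) :=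
          EqOn.of_subset_closure hz (hκ.mono (Icc_subset_Icc ht.1 hs.2)) continuousOn_const
            Ioo_subset_Icc_self (closure_Ioo hts.ne).ge
        exact this (left_mem_Icc.2 hts.le)
      have hzas : ∀ x ∈ Ioo a s, x ∈ Ioo (0 : ℝ) 1 → κ x = 0 := by
        intro x hx hx'
        rcases lt_trichotomy x t with h1 | h1 | h1
        · exact hza x ⟨hx.1, h1⟩ hx'
        · rw [h1, hzt]
        · exact hz x ⟨h1, hx.2⟩
      obtain ⟨α', β', hae'⟩ := haff a s (hat.trans hts) hzas
      obtain ⟨rfl, rfl⟩ := affine_eq_of_ae_eq hat hae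
        (ae_restrict_of_ae_restrict_of_subset (Ioo_subset_Ioo_right hts.le) hae')
      refine ⟨α, β, ?_, Or.inr ⟨a, hat.trans hts, hzas, hae'⟩⟩
      rw [split t ht s hs, hI, hibp t ht s hs hts α β
        (ae_restrict_of_ae_restrict_of_subset (Ioo_subset_Ioo_left hat.le) hae')]
      ring
  have hpI : ∀ j, p j ∈ Icc (0 : ℝ) 1 := fun j =>
    ⟨hp0 ▸ hp.monotone (Fin.zero_le j), hp1 ▸ hp.monotone (Fin.le_last j)⟩
  have hall : ∀ j : Fin (m + 1), Inv (p j) := by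
    intro j
    induction j using Fin.induction with
    | zero => rw [hp0]; exact inv0
    | succ i hi =>
      rcases hk i with hne | hz
      · exact stepN _ (hpI _) _ (hpI _) (hp Fin.castSucc_lt_succ) hne hi
      · exact stepZ _ (hpI _) _ (hpI _) (hp Fin.castSucc_lt_succ) hz hi
  have inv1 : Inv 1 := hp1 ▸ hall (Fin.last m)
  rw [← integral_Ioc_eq_integral_Ioo, ← intervalIntegral.integral_of_le zero_le_one]
  obtain ⟨α, β, hI, ⟨h1, h2⟩ | ⟨a, ha, hza, hae⟩⟩ := inv1
  · rw [hI, h1, h2]; ring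
  -- If `κ = 0` up to the end point `1`, then `H` is affine on `(a, 2)` and zero on `(1, 2)`; hence
  -- both coefficients vanish.
  · obtain ⟨α', β', hae'⟩ := haff a 2 (by linarith) fun x hx hx' => hza x ⟨hx.1, hx'.2⟩ hx'
    obtain ⟨rfl, rfl⟩ := affine_eq_of_ae_eq ha hae
      (ae_restrict_of_ae_restrict_of_subset (Ioo_subset_Ioo_right (by norm_num)) hae')
    have h0 : ∀ᵐ x ∂(volume.restrict (Ioo (1 : ℝ) 2)), H x = 0 + 0 * x := by
      filter_upwards [ae_restrict_mem measurableSet_Ioo] with x hx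
      rw [hH, indicator_of_notMem (fun hx' => absurd hx.1 (not_lt.2 hx'.2.le))]
      simp
    obtain ⟨rfl, rfl⟩ := affine_eq_of_ae_eq one_lt_two
      (ae_restrict_of_ae_restrict_of_subset (Ioo_subset_Ioo_left ha.le) hae') h0
    rw [hI]; ring

end ThinBeam

/-! ### Moments in `x₁` and orthogonality in `L²(ω)` -/

noncomputable section

namespace ThinBeam

/-- Lebesgue measure on `(0, L)`. -/
abbrev muX (L : ℝ) : Measure ℝ := volume.restrict (Ioo 0 L)

/-- Lebesgue measure on `(0, 1)`. -/
abbrev muS : Measure ℝ := volume.restrict (Ioo 0 1)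

theorem muOmega_eq_prod (L : ℝ) : muOmega L = (muX L).prod muS := by
  rw [muX, muS, Measure.prod_restrict]; rfl

/-- The moment `s ↦ ∫ f(x₁) k(x₁, s) dx₁`. -/
def moment (L : ℝ) (f : ℝ → ℝ) (k : ℝ × ℝ → ℝ) (s : ℝ) : ℝ := ∫ x, f x * k (x, s) ∂(muX L)

theorem inner_toLp_eq_integral {α : Type*} [MeasurableSpace α] {μ : Measure α} {u v : α → ℝ}
    (hu : MemLp u 2 μ) (hv : MemLp v 2 μ) : ⟪hu.toLp u, hv.toLp v⟫ = ∫ x, u x * v x ∂μ := by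
  rw [L2.inner_def]
  refine integral_congr_ae ?_
  filter_upwards [hu.coeFn_toLp, hv.coeFn_toLp] with x h1 h2
  rw [h1, h2]
  simp [mul_comm]

theorem inner_toLp_left_eq_integral {α : Type*} [MeasurableSpace α] {μ : Measure α} {u : α → ℝ}
    (hu : MemLp u 2 μ) (z : Lp ℝ 2 μ) : ⟪hu.toLp u, z⟫ = ∫ x, u x * z x ∂μ := by
  conv_lhs => rw [← Lp.toLp_coeFn z (Lp.memLp z)]
  exact inner_toLp_eq_integral hu (Lp.memLp z)

theorem sq_integral_mul_le {α : Type*} [MeasurableSpace α] {μ : Measure α} {u v : α → ℝ}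
    (hu : MemLp u 2 μ) (hv : MemLp v 2 μ) :
    (∫ x, u x * v x ∂μ) ^ 2 ≤ (∫ x, u x ^ 2 ∂μ) * ∫ x, v x ^ 2 ∂μ := by
  have h := real_inner_mul_inner_self_le (hu.toLp u) (hv.toLp v)
  simp only [inner_toLp_eq_integral] at h
  simpa only [sq] using h

variable {L : ℝ} {k : ℝ × ℝ → ℝ}

theorem ae_memLp_slice_left (hk : MemLp k 2 (muOmega L)) :
    ∀ᵐ x ∂(muX L), MemLp (fun s => k (x, s)) 2 muS := by
  rw [muOmega_eq_prod] at hk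
  filter_upwards [hk.1.prodMk_left, hk.integrable_sq.prod_right_ae] with x h1 h2
  exact (memLp_two_iff_integrable_sq h1).2 h2

theorem ae_memLp_slice_right (hk : MemLp k 2 (muOmega L)) :
    ∀ᵐ s ∂muS, MemLp (fun x => k (x, s)) 2 (muX L) := by
  rw [muOmega_eq_prod] at hk
  filter_upwards [hk.1.prod_swap.prodMk_left, hk.integrable_sq.prod_left_ae] with x h1 h2
  exact (memLp_two_iff_integrable_sq h1).2 h2

theorem memLp_of_continuous {f : ℝ → ℝ} (hf : Continuous f) (a b : ℝ) (p : ENNReal) :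
    MemLp f p (volume.restrict (Ioo a b)) := by
  obtain ⟨C, hC⟩ := isCompact_Icc.exists_bound_of_continuousOn (s := Icc a b) hf.continuousOn
  refine MemLp.of_bound hf.aestronglyMeasurable C ?_
  filter_upwards [ae_restrict_mem measurableSet_Ioo] with x hx
  exact hC x (Ioo_subset_Icc_self hx)

theorem memLp_mul_of_continuous {f : ℝ → ℝ} (hf : Continuous f) (hk : MemLp k 2 (muOmega L)) :
    MemLp (fun q : ℝ × ℝ => f q.1 * k q) 2 (muOmega L) := by
  obtain ⟨C, hC⟩ := isCompact_Icc.exists_bound_of_continuousOn (s := Icc 0 L) hf.continuousOn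
  refine (hk.const_mul C).mono ((hf.comp continuous_fst).aestronglyMeasurable.mul hk.1) ?_
  have hm : MeasurableSet (omega L) := measurableSet_Ioo.prod measurableSet_Ioo
  filter_upwards [show ∀ᵐ q ∂(muOmega L), q ∈ omega L from ae_restrict_mem hm] with q hq
  rw [norm_mul, norm_mul]
  exact mul_le_mul_of_nonneg_right ((hC _ (Ioo_subset_Icc_self hq.1)).trans (le_abs_self C))
    (norm_nonneg _)

/-- By Cauchy–Schwarz in `x₁`, the squared moment at `s` is at most `∫ f²` times `∫ k(x, s)² dx`,
which is integrable in `s`. -/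
theorem memLp_moment {f : ℝ → ℝ} (hf : Continuous f) (hk : MemLp k 2 (muOmega L)) :
    MemLp (moment L f k) 2 muS := by
  have hfk := memLp_mul_of_continuous hf hk
  rw [muOmega_eq_prod] at hfk
  have hm : AEStronglyMeasurable (moment L f k) muS := hfk.1.prod_swap.integral_prod_right'
  rw [memLp_two_iff_integrable_sq hm]
  have hk' := hk
  rw [muOmega_eq_prod] at hk'
  refine Integrable.mono' (hk'.integrable_sq.integral_prod_right.const_mul
    (∫ x, f x ^ 2 ∂(muX L))) (hm.pow 2) ?_
  filter_upwards [ae_memLp_slice_right hk] with s hs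
  rw [Real.norm_eq_abs, abs_of_nonneg (sq_nonneg _)]
  exact sq_integral_mul_le (memLp_of_continuous hf 0 L 2) hs

theorem integrable_mul_snd {z : ℝ → ℝ} (hk : MemLp k 2 (muOmega L)) (hz : MemLp z 2 muS) :
    Integrable (fun q : ℝ × ℝ => k q * z q.2) (muOmega L) := by
  rw [muOmega_eq_prod] at *
  exact hk.integrable_mul (hz.comp_snd (muX L))

theorem integral_mul_eq_integral_moment {f z : ℝ → ℝ} (hf : Continuous f)
    (hk : MemLp k 2 (muOmega L)) (hz : MemLp z 2 muS) :
    ∫ q, f q.1 * k q * z q.2 ∂(muOmega L) = ∫ s, moment L f k s * z s ∂muS := by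
  have hi := integrable_mul_snd (memLp_mul_of_continuous hf hk) hz
  rw [muOmega_eq_prod] at *
  rw [integral_prod_symm _ hi]
  simp only [integral_mul_const, moment]

theorem integral_mul_slice_eq_integral_moment {f z : ℝ → ℝ} (hf : Continuous f)
    (hk : MemLp k 2 (muOmega L)) (hz : MemLp z 2 muS) :
    ∫ x, f x * (∫ s, k (x, s) * z s ∂muS) ∂(muX L) = ∫ s, moment L f k s * z s ∂muS := by
  rw [← integral_mul_eq_integral_moment hf hk hz]
  have hi := integrable_mul_snd (memLp_mul_of_continuous hf hk) hz
  rw [muOmega_eq_prod] at *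
  rw [integral_prod _ hi]
  simp only [mul_assoc, integral_const_mul]

theorem ae_integral_slice_eq_zero {z : ℝ → ℝ} (hk : MemLp k 2 (muOmega L)) (hz : MemLp z 2 muS)
    (h : ∀ f, IsTestOn 0 L f → ∫ s, moment L f k s * z s ∂muS = 0) :
    ∀ᵐ x ∂(muX L), ∫ s, k (x, s) * z s ∂muS = 0 := by
  refine ae_eq_zero_of_forall_isTestOn ?_ fun f hf => ?_
  · have hi := integrable_mul_snd hk hz
    rw [muOmega_eq_prod] at hi
    exact hi.integral_prod_left
  · exact (integral_mul_slice_eq_integral_moment hf.continuous hk hz).trans (h f hf)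

/-- If all moments of `h` are orthogonal to all moments of `b`, then `h` is orthogonal to `b`. -/
theorem integral_mul_eq_zero_of_moments {h b : ℝ × ℝ → ℝ} (hh : MemLp h 2 (muOmega L))
    (hb : MemLp b 2 (muOmega L))
    (H : ∀ f g, IsTestOn 0 L f → IsTestOn 0 L g →
      ∫ s, moment L f h s * moment L g b s ∂muS = 0) :
    ∫ q, h q * b q ∂(muOmega L) = 0 := by
  have : Fact ((2 : ENNReal) ≠ ⊤) := ⟨by simp⟩
  let S : Set (Lp ℝ 2 muS) :=
    {z | ∃ (g : ℝ → ℝ) (hg : IsTestOn 0 L g), z = (memLp_moment hg.continuous hb).toLp _}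
  -- `K` is the closed span of the moments of `b`. It will turn out that almost every slice `b(x,
  -- ·)` lies in `K` and almost every slice `h(x, ·)` is orthogonal to `K`.
  let K : Submodule ℝ (Lp ℝ 2 muS) := (Submodule.span ℝ S).topologicalClosure
  have : CompleteSpace K :=
    (Submodule.isClosed_topologicalClosure _).completeSpace_coe
  have h1 : ∀ z ∈ K, ∀ᵐ x ∂(muX L), ∫ s, h (x, s) * z s ∂muS = 0 := by
    intro z hz
    refine ae_integral_slice_eq_zero hh (Lp.memLp z) fun f hf => ?_
    have hle : K ≤ (Submodule.span ℝ {(memLp_moment hf.continuous hh).toLp _})ᗮ := by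
      refine Submodule.topologicalClosure_minimal _ (Submodule.span_le.2 ?_)
        (Submodule.isClosed_orthogonal _)
      rintro _ ⟨g, hg, rfl⟩
      rw [SetLike.mem_coe, Submodule.mem_orthogonal_singleton_iff_inner_right,
        inner_toLp_eq_integral]
      exact H f g hf hg
    have := hle hz
    rwa [Submodule.mem_orthogonal_singleton_iff_inner_right, inner_toLp_left_eq_integral] at this
  have h2 : ∀ z ∈ Kᗮ, ∀ᵐ x ∂(muX L), ∫ s, b (x, s) * z s ∂muS = 0 := by
    intro z hz
    refine ae_integral_slice_eq_zero hb (Lp.memLp z) fun f hf => ?_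
    rw [← inner_toLp_left_eq_integral (memLp_moment hf.continuous hb)]
    exact (Submodule.mem_orthogonal _ _).1 hz _
      (Submodule.le_topologicalClosure _ (Submodule.subset_span ⟨f, hf, rfl⟩))
  -- The exceptional null set of `x` depends on `z`; a countable dense family of `z` provides a
  -- common one.
  have hd := TopologicalSpace.denseRange_denseSeq (Lp ℝ 2 muS)
  set z := TopologicalSpace.denseSeq (Lp ℝ 2 muS)
  have h1' := ae_all_iff.2 fun i => h1 _ (K.starProjection_apply_mem (z i))
  have h2' := ae_all_iff.2 fun i => h2 _ (K.sub_starProjection_mem_orthogonal (z i))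
  have hi : Integrable (fun q => h q * b q) (muOmega L) := hh.integrable_mul hb
  rw [muOmega_eq_prod] at hi ⊢
  rw [integral_prod _ hi]
  refine integral_eq_zero_of_ae ?_
  filter_upwards [ae_memLp_slice_left hh, ae_memLp_slice_left hb, h1', h2'] with x mh mb e1 e2
  rw [Pi.zero_apply, ← inner_toLp_eq_integral mh mb]
  have p1 : K.starProjection (mh.toLp _) = 0 := by
    refine hd.eq_zero_of_inner_left ℝ fun i => ?_
    rw [Submodule.inner_starProjection_left_eq_right, inner_toLp_left_eq_integral]
    exact e1 i
  have p2 : mb.toLp _ - K.starProjection (mb.toLp _) = 0 := by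
    refine hd.eq_zero_of_inner_left ℝ fun i => ?_
    rw [inner_sub_left, Submodule.inner_starProjection_left_eq_right, ← inner_sub_right,
      inner_toLp_left_eq_integral]
    exact e2 i
  rw [sub_eq_zero.1 p2, ← Submodule.inner_starProjection_left_eq_right, p1, inner_zero_left]

end ThinBeam

end

/-! ### The moving frame and explicit infinitesimal isometries -/

noncomputable section

namespace ThinBeam

theorem inner_E3 (x y : E3) : ⟪x, y⟫ = x 0 * y 0 + x 1 * y 1 + x 2 * y 2 := by
  simp only [PiLp.inner_apply, Fin.sum_univ_three, Real.inner_apply]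

theorem hasDerivWithinAt_E3 {f : ℝ → E3} {f' : E3} {S : Set ℝ} {x : ℝ} :
    HasDerivWithinAt f f' S x ↔ ∀ i, HasDerivWithinAt (fun y => f y i) (f' i) S x := by
  rw [hasDerivWithinAt_iff_hasFDerivWithinAt, hasFDerivWithinAt_euclidean]
  refine forall_congr' fun i => ?_
  rw [hasDerivWithinAt_iff_hasFDerivWithinAt]
  refine iff_of_eq (congrArg₂ _ ?_ rfl)
  ext
  simp

theorem hasDerivAt_E3 {f : ℝ → E3} {f' : E3} {x : ℝ} :
    HasDerivAt f f' x ↔ ∀ i, HasDerivAt (fun y => f y i) (f' i) x := by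
  simp only [← hasDerivWithinAt_univ, hasDerivWithinAt_E3]

/-- Extending `g` continuously to the line by `IccExtend` does not change the primitive on `[0, 1]`
and makes it differentiable at the end points too. The gain of one derivative is not needed and is
dropped. -/
theorem contDiffOn_primitive {g : ℝ → ℝ} {n : ℕ} (hg : ContDiffOn ℝ n g (Icc 0 1)) :
    ContDiffOn ℝ n (fun s => ∫ t in (0 : ℝ)..s, g t) (Icc 0 1) := by
  set G : ℝ → ℝ := IccExtend zero_le_one ((Icc (0 : ℝ) 1).domRestrict g)
  have hG : Continuous G := (continuousOn_iff_continuous_domRestrict.1 hg.continuousOn).Icc_extend'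
  have hGg : EqOn G g (Icc 0 1) := fun x hx => by
    exact IccExtend_of_mem _ _ hx
  have hF : EqOn (fun s => ∫ t in (0 : ℝ)..s, g t) (fun s => ∫ t in (0 : ℝ)..s, G t) (Icc 0 1) :=
    fun s hs => intervalIntegral.integral_congr fun t ht => by
      rw [uIcc_of_le hs.1] at ht
      exact (hGg ⟨ht.1, ht.2.trans hs.2⟩).symm
  have hd : ∀ s, HasDerivAt (fun s => ∫ t in (0 : ℝ)..s, G t) (G s) s := fun s =>
    (hG.integral_hasStrictDerivAt 0 s).hasDerivAt
  refine ContDiffOn.congr (ContDiffOn.of_le (n := (n : WithTop ℕ∞) + 1) ?_ le_self_add) hF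
  rw [contDiffOn_succ_iff_derivWithin (uniqueDiffOn_Icc zero_lt_one)]
  refine ⟨fun s _ => (hd s).differentiableAt.differentiableWithinAt, by simp, ?_⟩
  refine hg.congr fun s hs => ?_
  rw [(hd s).hasDerivWithinAt.derivWithin (uniqueDiffOn_Icc zero_lt_one s hs), hGg hs]

section Frame

variable {γ : ℝ → E3}

theorem IsSimplePlanarCurve.contDiffOn_tangent (hγ : IsSimplePlanarCurve γ) :
    ContDiffOn ℝ 5 (tangent γ) (Icc 0 1) := by
  have h : ContDiffOn ℝ (5 + 1) γ (Icc 0 1) := hγ.contDiffOn.of_le (by norm_num)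
  exact ((contDiffOn_succ_iff_derivWithin (uniqueDiffOn_Icc zero_lt_one)).1 h).2.2

theorem IsSimplePlanarCurve.contDiffOn_tangent_apply (hγ : IsSimplePlanarCurve γ) (i : Fin 3) :
    ContDiffOn ℝ 5 (fun s => tangent γ s i) (Icc 0 1) :=
  contDiffOn_euclidean.1 hγ.contDiffOn_tangent i

theorem IsSimplePlanarCurve.contDiffOn_normal (hγ : IsSimplePlanarCurve γ) :
    ContDiffOn ℝ 5 (normal γ) (Icc 0 1) := by
  refine contDiffOn_euclidean.2 fun i => ?_
  fin_cases i
  · exact contDiffOn_const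
  · exact (hγ.contDiffOn_tangent_apply 2).neg
  · exact hγ.contDiffOn_tangent_apply 1

theorem IsSimplePlanarCurve.tangent_zero (hγ : IsSimplePlanarCurve γ)
    {s : ℝ} (hs : s ∈ Icc (0 : ℝ) 1) : tangent γ s 0 = 0 := by
  have hd : HasDerivWithinAt γ (tangent γ s) (Icc 0 1) s :=
    ((hγ.contDiffOn.differentiableOn (by norm_num)) s hs).hasDerivWithinAt
  have h0 := hasDerivWithinAt_E3.1 hd 0
  have h1 : HasDerivWithinAt (fun y => γ y 0) 0 (Icc 0 1) s :=
    (hasDerivWithinAt_const s _ (0 : ℝ)).congr hγ.planar (hγ.planar s hs)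
  exact (uniqueDiffOn_Icc zero_lt_one s hs).eq_deriv _ h0 h1

theorem IsSimplePlanarCurve.tangent_sq (hγ : IsSimplePlanarCurve γ)
    {s : ℝ} (hs : s ∈ Icc (0 : ℝ) 1) :
    tangent γ s 1 ^ 2 + tangent γ s 2 ^ 2 = 1 := by
  have h := hγ.unit_speed s hs
  have h2 : ⟪tangent γ s, tangent γ s⟫ = 1 := by rw [real_inner_self_eq_norm_sq, h, one_pow]
  rw [inner_E3, hγ.tangent_zero hs] at h2
  linarith

theorem IsSimplePlanarCurve.continuousOn_curvature (hγ : IsSimplePlanarCurve γ) :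
    ContinuousOn (curvature γ) (Icc 0 1) := by
  have h : ContDiffOn ℝ (4 + 1) (tangent γ) (Icc 0 1) := hγ.contDiffOn_tangent.of_le (by norm_num)
  have h2 := ((contDiffOn_succ_iff_derivWithin (uniqueDiffOn_Icc zero_lt_one)).1 h).2.2.continuousOn
  exact h2.inner hγ.contDiffOn_normal.continuousOn

/-- Differentiating `|τ|² = 1` shows that `τ'` has no tangential part, so `τ' = k n`. -/
theorem IsSimplePlanarCurve.hasDerivAt_tangent (hγ : IsSimplePlanarCurve γ)
    {s : ℝ} (hs : s ∈ Ioo (0 : ℝ) 1) :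
    HasDerivAt (fun t => tangent γ t 1) (-(curvature γ s * tangent γ s 2)) s ∧
    HasDerivAt (fun t => tangent γ t 2) (curvature γ s * tangent γ s 1) s := by
  have hs' := Ioo_subset_Icc_self hs
  have hnhds : Icc (0 : ℝ) 1 ∈ 𝓝 s := Icc_mem_nhds hs.1 hs.2
  have hd : HasDerivAt (tangent γ) (derivWithin (tangent γ) (Icc 0 1) s) s :=
    ((hγ.contDiffOn_tangent.differentiableOn (by norm_num)) s hs').hasDerivWithinAt.hasDerivAt hnhds
  have hc := hasDerivAt_E3.1 hd
  have hsq : HasDerivAt (fun t => tangent γ t 1 ^ 2 + tangent γ t 2 ^ 2) 0 s :=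
    (hasDerivAt_const s (1 : ℝ)).congr_of_eventuallyEq
      (by filter_upwards [hnhds] with t ht using hγ.tangent_sq ht)
  have h0 := (((hc 1).pow 2).add ((hc 2).pow 2)).unique hsq
  have h1 := hγ.tangent_sq hs'
  have hk : curvature γ s = -(derivWithin (tangent γ) (Icc 0 1) s 1 * tangent γ s 2) +
      derivWithin (tangent γ) (Icc 0 1) s 2 * tangent γ s 1 := by
    rw [curvature, inner_E3]
    simp [normal]
  norm_num at h0
  set a := derivWithin (tangent γ) (Icc 0 1) s 1
  set c := derivWithin (tangent γ) (Icc 0 1) s 2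
  refine ⟨(hc 1).congr_deriv ?_, (hc 2).congr_deriv ?_⟩
  · rw [hk]
    linear_combination (-a) * h1 + tangent γ s 1 / 2 * h0
  · rw [hk]
    linear_combination (-c) * h1 + tangent γ s 2 / 2 * h0

theorem IsSimplePlanarCurve.hasDerivAt_normal (hγ : IsSimplePlanarCurve γ)
    {s : ℝ} (hs : s ∈ Ioo (0 : ℝ) 1) :
    HasDerivAt (normal γ) (-curvature γ s • tangent γ s) s := by
  obtain ⟨h1, h2⟩ := hγ.hasDerivAt_tangent hs
  refine hasDerivAt_E3.2 fun i => ?_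
  fin_cases i
  · have := hasDerivAt_const s (0 : ℝ)
    simpa [normal, hγ.tangent_zero (Ioo_subset_Icc_self hs)] using this
  · simpa [normal] using h2.fun_neg
  · simpa [normal] using h1

theorem IsSimplePlanarCurve.inner_normal_normal (hγ : IsSimplePlanarCurve γ)
    {s : ℝ} (hs : s ∈ Icc (0 : ℝ) 1) :
    ⟪normal γ s, normal γ s⟫ = 1 := by
  rw [inner_E3]
  simp [normal]
  linarith [hγ.tangent_sq hs]

end Frame

theorem inner_normal_tangent (γ : ℝ → E3) (s : ℝ) : ⟪normal γ s, tangent γ s⟫ = 0 := by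
  rw [inner_E3]
  simp [normal]
  ring

theorem normal_zero (γ : ℝ → E3) (s : ℝ) : normal γ s 0 = 0 := by simp [normal]

/-- The unit vector `e₁`. -/
def unit1 : E3 := !₂[1, 0, 0]

/-- `φ` is an infinitesimal isometry of class `C⁵` with bending moment `β`. -/
def HasBending (L : ℝ) (γ : ℝ → E3) (φ : ℝ × ℝ → E3) (β : ℝ × ℝ → ℝ) : Prop :=
  ContDiffOn ℝ 5 φ (omegaBar L) ∧ ∃ (θ ρ : ℝ × ℝ → ℝ) (d : ℝ × ℝ → E3), ∀ q ∈ omega L,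
    HasDerivAt (fun x => φ (x, q.2)) (d q) q.1 ∧
    HasDerivAt (fun s => φ (q.1, s)) (ρ q • unit1 + θ q • normal γ q.2) q.2 ∧
    d q 0 = 0 ∧ ρ q + ⟪d q, tangent γ q.2⟫ = 0 ∧
    HasDerivAt (fun s => θ (q.1, s)) (β q) q.2

namespace HasBending

variable {L : ℝ} {γ : ℝ → E3} {φ φ' : ℝ × ℝ → E3} {β β' : ℝ × ℝ → ℝ}

theorem zero : HasBending L γ (fun _ => 0) (fun _ => 0) := by
  refine ⟨contDiffOn_const, fun _ => 0, fun _ => 0, fun _ => 0, fun q _ => ?_⟩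
  refine ⟨hasDerivAt_const _ _, ?_, rfl, by simp, hasDerivAt_const _ _⟩
  simpa using hasDerivAt_const q.2 (0 : E3)

theorem add (h : HasBending L γ φ β) (h' : HasBending L γ φ' β') :
    HasBending L γ (fun q => φ q + φ' q) (fun q => β q + β' q) := by
  obtain ⟨hc, θ, ρ, d, H⟩ := h
  obtain ⟨hc', θ', ρ', d', H'⟩ := h'
  refine ⟨hc.add hc', fun q => θ q + θ' q, fun q => ρ q + ρ' q, fun q => d q + d' q, fun q hq => ?_⟩
  obtain ⟨a1, a2, a3, a4, a5⟩ := H q hq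
  obtain ⟨b1, b2, b3, b4, b5⟩ := H' q hq
  refine ⟨a1.add b1, (a2.add b2).congr_deriv ?_, ?_, ?_, a5.add b5⟩
  · module
  · simp [a3, b3]
  · rw [inner_add_left]; linarith

theorem smul (c : ℝ) (h : HasBending L γ φ β) :
    HasBending L γ (fun q => c • φ q) (fun q => c * β q) := by
  obtain ⟨hc, θ, ρ, d, H⟩ := h
  refine ⟨contDiffOn_const.fun_smul hc, fun q => c * θ q, fun q => c * ρ q, fun q => c • d q,
    fun q hq => ?_⟩
  obtain ⟨a1, a2, a3, a4, a5⟩ := H q hq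
  refine ⟨a1.const_smul c, (a2.const_smul c).congr_deriv ?_, ?_, ?_, a5.const_mul c⟩
  · module
  · simp [a3]
  · rw [inner_smul_left]; simp; linear_combination c * a4

/-- The form `ρ e₁ + θ n` of `∂ₛ φ` already contains `∂ₛ φ · τ = 0`, and identifies `ρ` with `∂ₛ φ₁`
and `θ` with `∂ₛ φ · n`. -/
theorem pds_eq (h : HasBending L γ φ β) (hγ : IsSimplePlanarCurve γ) :
    (∀ q ∈ omega L, symGrad γ φ q = 0) ∧ ∀ q ∈ omega L, bending γ φ q = β q := by
  obtain ⟨hc, θ, ρ, d, H⟩ := h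
  have e2 : ∀ q ∈ omega L, pds φ q = ρ q • unit1 + θ q • normal γ q.2 := fun q hq =>
    (H q hq).2.1.deriv
  constructor
  · intro q hq
    have hs : q.2 ∈ Icc (0 : ℝ) 1 := Ioo_subset_Icc_self hq.2
    have e1 : pd1 φ q = d q := (H q hq).1.deriv
    have e3 : pds φ q 0 = ρ q := by
      rw [e2 q hq]; simp [unit1, normal_zero]
    have e4 : ⟪pds φ q, tangent γ q.2⟫ = 0 := by
      rw [e2 q hq, inner_add_left, inner_smul_left, inner_smul_left, inner_normal_tangent, inner_E3]
      simp [unit1, hγ.tangent_zero hs]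
    obtain ⟨-, -, a3, a4, -⟩ := H q hq
    ext i j
    fin_cases i <;> fin_cases j <;> simp [symGrad, e1, e3, e4, a3, a4]
  · intro q hq
    have e5 : ∀ s ∈ Ioo (0 : ℝ) 1, ⟪pds φ (q.1, s), normal γ s⟫ = θ (q.1, s) := by
      intro s hs
      rw [e2 (q.1, s) ⟨hq.1, hs⟩, inner_add_left, inner_smul_left, inner_smul_left,
        hγ.inner_normal_normal (Ioo_subset_Icc_self hs), inner_E3]
      simp [unit1, normal_zero]
    refine ((H q hq).2.2.2.2.congr_of_eventuallyEq ?_).deriv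
    filter_upwards [isOpen_Ioo.mem_nhds hq.2] with s hs using e5 s hs

end HasBending

variable {L : ℝ} {γ : ℝ → E3}

theorem contDiffOn_comp_snd {F : Type*} [NormedAddCommGroup F] [NormedSpace ℝ F] {g : ℝ → F}
    (hg : ContDiffOn ℝ 5 g (Icc 0 1)) : ContDiffOn ℝ 5 (fun q : ℝ × ℝ => g q.2) (omegaBar L) :=
  hg.comp contDiff_snd.contDiffOn fun _ hq => hq.2

/-- Normal displacements `f(x₁) W(s) n(s)` supported where the curvature vanishes. -/
theorem hasBending_normal (hγ : IsSimplePlanarCurve γ) {f W : ℝ → ℝ} (hf : ContDiff ℝ ∞ f)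
    (hW : ContDiff ℝ ∞ W) (hWk : ∀ s ∈ Ioo (0 : ℝ) 1, W s * curvature γ s = 0) :
    HasBending L γ (fun q => (f q.1 * W q.2) • normal γ q.2)
      (fun q => f q.1 * deriv (deriv W) q.2) := by
  have df : ∀ x, HasDerivAt f (deriv f x) x := fun x => (hf.differentiable (by simp) x).hasDerivAt
  have dW : ∀ x, HasDerivAt W (deriv W x) x := fun x => (hW.differentiable (by simp) x).hasDerivAt
  have hW' := (contDiff_infty_iff_deriv.1 hW).2
  have dW' : ∀ x, HasDerivAt (deriv W) (deriv (deriv W) x) x := fun x =>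
    (hW'.differentiable (by simp) x).hasDerivAt
  refine ⟨?_, fun q => f q.1 * deriv W q.2, fun _ => 0,
    fun q => (deriv f q.1 * W q.2) • normal γ q.2, fun q hq => ⟨?_, ?_, ?_, ?_, ?_⟩⟩
  · refine ContDiffOn.fun_smul (ContDiff.contDiffOn ?_) (contDiffOn_comp_snd hγ.contDiffOn_normal)
    exact ((contDiff_infty.1 hf 5).comp contDiff_fst).mul ((contDiff_infty.1 hW 5).comp contDiff_snd)
  · exact ((df q.1).mul_const (W q.2)).smul_const (normal γ q.2)
  -- Since `n' = -k τ`, the derivative of the normal contributes `-f W k τ`, which vanishes by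
  -- `hWk`.
  · refine (((dW q.2).const_mul (f q.1)).smul (hγ.hasDerivAt_normal hq.2)).congr_deriv ?_
    have h0 := hWk q.2 hq.2
    rw [smul_smul, show f q.1 * W q.2 * -curvature γ q.2 = 0 by linear_combination -f q.1 * h0]
    simp
  · simp [normal_zero]
  · simp [inner_smul_left, inner_normal_tangent]
  · exact (dW' q.2).const_mul (f q.1)

/-- Displacements affine in `x₁` with a prescribed bending moment `(α₀ + α₁ x₁) g(s)`. -/
theorem exists_hasBending_affine (hγ : IsSimplePlanarCurve γ) (α₀ α₁ : ℝ) {g : ℝ → ℝ}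
    (hg : ContDiff ℝ ∞ g) :
    ∃ φ, HasBending L γ φ (fun q => (α₀ + α₁ * q.1) * g q.2) := by
  set t1 : ℝ → ℝ := fun s => tangent γ s 1
  set t2 : ℝ → ℝ := fun s => tangent γ s 2
  have ht1 : ContDiffOn ℝ (5 : ℕ) t1 (Icc 0 1) := hγ.contDiffOn_tangent_apply 1
  have ht2 : ContDiffOn ℝ (5 : ℕ) t2 (Icc 0 1) := hγ.contDiffOn_tangent_apply 2
  set Θ : ℝ → ℝ := fun s => ∫ t in (0 : ℝ)..s, g t
  have hΘ : ContDiffOn ℝ (5 : ℕ) Θ (Icc 0 1) := contDiffOn_primitive (contDiff_infty.1 hg 5).contDiffOn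
  set y1 : ℝ → ℝ := fun s => ∫ t in (0 : ℝ)..s, -(Θ t * t2 t)
  set y2 : ℝ → ℝ := fun s => ∫ t in (0 : ℝ)..s, Θ t * t1 t
  have hy1 : ContDiffOn ℝ (5 : ℕ) y1 (Icc 0 1) := contDiffOn_primitive (hΘ.mul ht2).neg
  have hy2 : ContDiffOn ℝ (5 : ℕ) y2 (Icc 0 1) := contDiffOn_primitive (hΘ.mul ht1)
  set A : ℝ → ℝ := fun s => ∫ t in (0 : ℝ)..s, (y1 t * t1 t + y2 t * t2 t)
  have hA' := (hy1.mul ht1).add (hy2.mul ht2)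
  have hA : ContDiffOn ℝ (5 : ℕ) A (Icc 0 1) := contDiffOn_primitive hA'
  have dprim : ∀ {G : ℝ → ℝ}, ContinuousOn G (Icc 0 1) → ∀ s ∈ Ioo (0 : ℝ) 1,
      HasDerivAt (fun s => ∫ t in (0 : ℝ)..s, G t) (G s) s := fun hG s hs => by
    simpa using hasDerivAt_primitive_of_continuousOn hG 0 hs
  let y : ℝ → E3 := fun s => !₂[0, y1 s, y2 s]
  have hy : ContDiffOn ℝ 5 y (Icc 0 1) := contDiffOn_euclidean.2 fun i => by
    fin_cases i
    · exact contDiffOn_const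
    · exact hy1
    · exact hy2
  have dy : ∀ s ∈ Ioo (0 : ℝ) 1, HasDerivAt y (Θ s • normal γ s) s := fun s hs =>
    hasDerivAt_E3.2 fun i => by
      fin_cases i
      · simpa [y, normal] using hasDerivAt_const s (0 : ℝ)
      · refine (dprim (hΘ.mul ht2).neg.continuousOn s hs).congr_deriv ?_
        simp [normal, t2]
      · simpa [y, normal] using dprim (hΘ.mul ht1).continuousOn s hs
  -- Here `y' = Θ n` and `Θ' = g` produce the moment. The axial term `-α₁ A e₁` with `A' = y · τ`
  -- cancels the shear `∂₁ φ · τ = α₁ y · τ`.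
  refine ⟨fun q => (α₀ + α₁ * q.1) • y q.2 + (-α₁ * A q.2) • unit1, ?_,
    fun q => (α₀ + α₁ * q.1) * Θ q.2, fun q => -α₁ * (y1 q.2 * t1 q.2 + y2 q.2 * t2 q.2),
    fun q => α₁ • y q.2, fun q hq => ⟨?_, ?_, ?_, ?_, ?_⟩⟩
  · refine ContDiffOn.add (ContDiffOn.fun_smul (ContDiff.contDiffOn ?_) (contDiffOn_comp_snd hy))
      (ContDiffOn.fun_smul (contDiffOn_const.mul (contDiffOn_comp_snd hA)) contDiffOn_const)
    exact contDiff_const.add (contDiff_const.mul contDiff_fst)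
  · have h1 : HasDerivAt (fun x : ℝ => α₀ + α₁ * x) α₁ q.1 := by
      simpa using ((hasDerivAt_id q.1).const_mul α₁).const_add α₀
    exact (h1.smul_const (y q.2)).add_const ((-α₁ * A q.2) • unit1)
  · refine (((dy q.2 hq.2).const_smul (α₀ + α₁ * q.1)).add
      (((dprim hA'.continuousOn q.2 hq.2).const_mul (-α₁)).smul_const unit1)).congr_deriv ?_
    rw [smul_smul, add_comm]
  · simp [y]
  · rw [inner_smul_left, inner_E3]
    simp [y, t1, t2]
  · have hgc : ContinuousOn g (Icc 0 1) := hg.continuous.continuousOn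
    exact (dprim hgc q.2 hq.2).const_mul (α₀ + α₁ * q.1)

end ThinBeam

end

/-! ### Annihilators of the bending moments are orthogonal to `𝓑` -/

noncomputable section

namespace ThinBeam

variable {L : ℝ} {γ : ℝ → E3} {f η : ℝ → ℝ}

theorem IsTestOn.tensor (hf : IsTestOn 0 L f) (hη : IsTestOn 0 1 η) :
    IsTest L (fun q => f q.1 * η q.2) := by
  have hs : tsupport (fun q : ℝ × ℝ => f q.1 * η q.2) ⊆ tsupport f ×ˢ tsupport η := by
    refine closure_minimal (fun q hq => ?_) ((isClosed_tsupport f).prod (isClosed_tsupport η))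
    have := mul_ne_zero_iff.1 hq
    exact ⟨subset_tsupport f this.1, subset_tsupport η this.2⟩
  exact ⟨(hf.smooth.comp contDiff_fst).mul (hη.smooth.comp contDiff_snd),
    (hf.compact.isCompact.prod hη.compact.isCompact).of_isClosed_subset (isClosed_tsupport _) hs,
    hs.trans (prod_mono hf.support hη.support)⟩

theorem pds_tensor (f η : ℝ → ℝ) (q : ℝ × ℝ) :
    pds (fun q => f q.1 * η q.2) q = f q.1 * deriv η q.2 := by
  simp [pds, deriv_const_mul_field]

theorem pd1_tensor (f η : ℝ → ℝ) :
    pd1 (fun q => f q.1 * η q.2) = fun q => deriv f q.1 * η q.2 := by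
  ext q
  simp [pd1, deriv_mul_const_field]

theorem memLp_of_continuousOn {z : ℝ → ℝ} (hz : ContinuousOn z (Icc 0 1)) : MemLp z 2 muS := by
  obtain ⟨C, hC⟩ := isCompact_Icc.exists_bound_of_continuousOn hz
  refine MemLp.of_bound ((hz.mono Ioo_subset_Icc_self).aestronglyMeasurable measurableSet_Ioo) C ?_
  filter_upwards [ae_restrict_mem measurableSet_Ioo] with x hx
  exact hC x (Ioo_subset_Icc_self hx)

theorem ae_muOmega_mem (L : ℝ) : ∀ᵐ q ∂(muOmega L), q ∈ omega L :=
  ae_restrict_mem (measurableSet_Ioo.prod measurableSet_Ioo)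

theorem memLp_comp_snd (L : ℝ) {z : ℝ → ℝ} (hz : MemLp z 2 muS) :
    MemLp (fun q : ℝ × ℝ => z q.2) 2 (muOmega L) := by
  rw [muOmega_eq_prod]
  exact hz.comp_snd (muX L)

theorem memLp_mul_snd_of_continuousOn {k : ℝ × ℝ → ℝ} {z : ℝ → ℝ} (hk : MemLp k 2 (muOmega L))
    (hz : ContinuousOn z (Icc 0 1)) : MemLp (fun q : ℝ × ℝ => k q * z q.2) 2 (muOmega L) := by
  obtain ⟨C, hC⟩ := isCompact_Icc.exists_bound_of_continuousOn hz
  refine (hk.const_mul C).mono (hk.1.mul (memLp_comp_snd L (memLp_of_continuousOn hz)).1) ?_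
  filter_upwards [ae_muOmega_mem L] with q hq
  rw [norm_mul, norm_mul, mul_comm]
  exact mul_le_mul_of_nonneg_right ((hC _ (Ioo_subset_Icc_self hq.2)).trans (le_abs_self C))
    (norm_nonneg _)

theorem moment_mul_snd (L : ℝ) (f : ℝ → ℝ) (k : ℝ × ℝ → ℝ) (z : ℝ → ℝ) (s : ℝ) :
    moment L f (fun q => k q * z q.2) s = moment L f k s * z s := by
  simp only [moment, ← mul_assoc, integral_mul_const]

/-- Moments of a weakly differentiable function are weakly differentiable. -/
theorem moment_weak_deriv {k k' : ℝ × ℝ → ℝ} (hk : MemLp k 2 (muOmega L))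
    (hk' : MemLp k' 2 (muOmega L)) (h : HasWeakPds L k k') (hf : IsTestOn 0 L f)
    (hη : IsTestOn 0 1 η) :
    ∫ s in Ioo 0 1, deriv η s * moment L f k s = -∫ s in Ioo 0 1, η s * moment L f k' s := by
  have H := h _ (hf.tensor hη)
  have e1 := integral_mul_eq_integral_moment hf.continuous hk
    (memLp_of_continuous hη.deriv.continuous 0 1 2)
  have e2 := integral_mul_eq_integral_moment hf.continuous hk'
    (memLp_of_continuous hη.continuous 0 1 2)
  simp only [mul_comm _ (moment L f _ _)]
  rw [← e1, ← e2]
  refine Eq.trans (integral_congr_ae (Eventually.of_forall fun q => ?_)) (H.trans ?_)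
  · simp only [pds_tensor, smul_eq_mul]; ring
  · congr 1
    refine integral_congr_ae (Eventually.of_forall fun q => ?_)
    simp only [smul_eq_mul]; ring

theorem HasWeakPds.apply {v w : ℝ × ℝ → E3} (hv : MemLp v 2 (muOmega L))
    (hw : MemLp w 2 (muOmega L)) (h : HasWeakPds L v w) (i : Fin 3) (hf : IsTestOn 0 L f)
    (hη : IsTestOn 0 1 η) :
    ∫ s in Ioo 0 1, deriv η s * moment L f (fun q => v q i) s =
      -∫ s in Ioo 0 1, η s * moment L f (fun q => w q i) s := by
  have H := congrArg (fun y : E3 => y i) (h _ (hf.tensor hη))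
  have i1 : ∀ j, Integrable (fun q => (pds (fun q => f q.1 * η q.2) q • v q) j) (muOmega L) := by
    intro j
    refine (integrable_mul_snd (memLp_mul_of_continuous hf.continuous (hv.eval_piLp j))
      (memLp_of_continuous hη.deriv.continuous 0 1 2)).congr (Eventually.of_forall fun q => ?_)
    simp only [pds_tensor, PiLp.smul_apply, smul_eq_mul]; ring
  have i2 : ∀ j, Integrable (fun q : ℝ × ℝ => ((f q.1 * η q.2) • w q) j) (muOmega L) := by
    intro j
    refine (integrable_mul_snd (memLp_mul_of_continuous hf.continuous (hw.eval_piLp j))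
      (memLp_of_continuous hη.continuous 0 1 2)).congr (Eventually.of_forall fun q => ?_)
    simp only [PiLp.smul_apply, smul_eq_mul]; ring
  simp only [PiLp.neg_apply] at H
  rw [eval_integral_piLp i1, eval_integral_piLp i2] at H
  have e1 := integral_mul_eq_integral_moment hf.continuous (hv.eval_piLp i)
    (memLp_of_continuous hη.deriv.continuous 0 1 2)
  have e2 := integral_mul_eq_integral_moment hf.continuous (hw.eval_piLp i)
    (memLp_of_continuous hη.continuous 0 1 2)
  simp only [mul_comm _ (moment L f _ _)]
  rw [← e1, ← e2]
  refine Eq.trans (integral_congr_ae (Eventually.of_forall fun q => ?_)) (H.trans ?_)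
  · simp only [pds_tensor, PiLp.smul_apply, smul_eq_mul]; ring
  · congr 1
    refine integral_congr_ae (Eventually.of_forall fun q => ?_)
    simp only [PiLp.smul_apply, smul_eq_mul]; ring

/-- Second-derivative moments of a bending moment in `𝓑` are orthogonal to the moments of any
`h` annihilating the bending moments of normal displacements. -/
theorem integral_moment_mul_moment_eq_zero (hγ : IsSimplePlanarCurve γ)
    {m : ℕ} {p : Fin (m + 1) → ℝ} (hp : StrictMono p)
    (hp0 : p 0 = 0) (hp1 : p (Fin.last m) = 1)
    (hk : ∀ i : Fin m, (∀ s ∈ Ioo (p i.castSucc) (p i.succ), curvature γ s ≠ 0) ∨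
      (∀ s ∈ Ioo (p i.castSucc) (p i.succ), curvature γ s = 0))
    {b h : ℝ × ℝ → ℝ} (hb : b ∈ classB L γ) (hh : MemLp h 2 (muOmega L))
    (H : ∀ f W : ℝ → ℝ, IsTestOn 0 L f → ContDiff ℝ ∞ W → HasCompactSupport W →
      (∀ s ∈ Ioo (0 : ℝ) 1, W s * curvature γ s = 0) →
      ∫ q, h q * (f q.1 * deriv (deriv W) q.2) ∂(muOmega L) = 0)
    {F : ℝ → ℝ} (hf : IsTestOn 0 L f) (hF : IsTestOn 0 L F) :
    ∫ s, moment L f h s * moment L (deriv (deriv F)) b s ∂muS = 0 := by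
  obtain ⟨mb, v, w, mv, mw, hvw, hwτ, hwb, hvτ⟩ := hb
  have hg := hF.deriv.deriv
  set g := deriv (deriv F)
  set t1 : ℝ → ℝ := fun s => tangent γ s 1 with ht1
  set t2 : ℝ → ℝ := fun s => tangent γ s 2 with ht2
  have c1 : ContinuousOn t1 (Icc 0 1) := (hγ.contDiffOn_tangent_apply 1).continuousOn
  have c2 : ContinuousOn t2 (Icc 0 1) := (hγ.contDiffOn_tangent_apply 2).continuousOn
  have mv1 : MemLp (fun q => v q 1) 2 (muOmega L) := mv.eval_piLp 1
  have mv2 : MemLp (fun q => v q 2) 2 (muOmega L) := mv.eval_piLp 2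
  have mw1 : MemLp (fun q => w q 1) 2 (muOmega L) := mw.eval_piLp 1
  have mw2 : MemLp (fun q => w q 2) 2 (muOmega L) := mw.eval_piLp 2
  set θ : ℝ × ℝ → ℝ := fun q => ⟪w q, normal γ q.2⟫ with hθdef
  have hθ : ∀ q, θ q = -(w q 1 * t2 q.2) + w q 2 * t1 q.2 := fun q => by
    simp only [hθdef, inner_E3]
    simp [normal, t1, t2]
  have mθ : MemLp θ 2 (muOmega L) := by
    rw [funext hθ]
    exact (memLp_mul_snd_of_continuousOn mw1 c2).neg.add (memLp_mul_snd_of_continuousOn mw2 c1)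
  -- Since `w · τ = 0`, the in-plane part of `w` is `θ n`; the axial component of `w` plays no role.
  have hw : ∀ᵐ q ∂(muOmega L), w q 1 = -(θ q * t2 q.2) ∧ w q 2 = θ q * t1 q.2 := by
    filter_upwards [hwτ, ae_muOmega_mem L] with q h1 h2
    have hs := Ioo_subset_Icc_self h2.2
    rw [inner_E3, hγ.tangent_zero hs] at h1
    have h3 := hγ.tangent_sq hs
    rw [hθ]
    constructor
    · linear_combination (-(w q 1)) * h3 + t1 q.2 * h1
    · linear_combination (-(w q 2)) * h3 + t2 q.2 * h1
  have slice : ∀ {P : ℝ × ℝ → Prop}, (∀ᵐ q ∂(muOmega L), P q) →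
      ∀ᵐ s ∂muS, ∀ᵐ x ∂(muX L), P (x, s) := fun hP => by
    rw [muOmega_eq_prod] at hP
    exact Measure.ae_ae_of_ae_prod (Measure.measurePreserving_swap.quasiMeasurePreserving.ae hP)
  have hw1 : ∀ᵐ s ∂muS, moment L g (fun q => w q 1) s = -(moment L g θ s * t2 s) := by
    filter_upwards [slice hw] with s hs
    rw [← moment_mul_snd, moment, moment, ← integral_neg]
    refine integral_congr_ae ?_
    filter_upwards [hs] with x hx
    rw [hx.1]; ring
  have hw2 : ∀ᵐ s ∂muS, moment L g (fun q => w q 2) s = moment L g θ s * t1 s := by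
    filter_upwards [slice hw] with s hs
    rw [← moment_mul_snd, moment, moment]
    refine integral_congr_ae ?_
    filter_upwards [hs] with x hx
    rw [hx.2]
  have int : ∀ {k : ℝ → ℝ}, MemLp k 2 muS → IntegrableOn k (Ioo 0 1) := fun hk =>
    hk.integrable (by norm_num)
  obtain ⟨Θ, W, cΘ, cW, hΘ, dW, hW⟩ := exists_normal_component (κ := curvature γ) c1 c2
    (fun s hs => (hγ.hasDerivAt_tangent hs).1) (fun s hs => (hγ.hasDerivAt_tangent hs).2)
    (fun s hs => hγ.tangent_sq hs)
    (int (memLp_moment hg.continuous mv1)) (int (memLp_moment hg.continuous mv2))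
    (int (memLp_moment hg.continuous mθ)) (int (memLp_moment hg.continuous mb))
    (fun η hη => by
      rw [hvw.apply mv mw 1 hg hη]
      congr 1
      refine integral_congr_ae ?_
      filter_upwards [hw1] with s hs
      rw [hs])
    (fun η hη => by
      rw [hvw.apply mv mw 2 hg hη]
      congr 1
      refine integral_congr_ae ?_
      filter_upwards [hw2] with s hs
      rw [hs])
    (fun η hη => moment_weak_deriv mθ mb hwb hg hη)
    (fun η hη => by
      -- The weight is a second derivative `F''` precisely so that `∂₁² v · τ = 0` applies.
      have h0 := hvτ _ (hF.tensor hη)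
      rw [pd1_tensor, pd1_tensor] at h0
      have i1 := memLp_mul_snd_of_continuousOn mv1 c1
      have i2 := memLp_mul_snd_of_continuousOn mv2 c2
      have e1 := integral_mul_eq_integral_moment hg.continuous (i1.add i2)
        (memLp_of_continuous hη.continuous 0 1 2)
      have e2 : ∀ᵐ s ∂muS, moment L g ((fun q => v q 1 * t1 q.2) + fun q => v q 2 * t2 q.2) s =
          moment L g (fun q => v q 1) s * t1 s + moment L g (fun q => v q 2) s * t2 s := by
        filter_upwards [ae_memLp_slice_right i1, ae_memLp_slice_right i2] with s h1 h2
        rw [← moment_mul_snd, ← moment_mul_snd, moment, moment, moment, ← integral_add]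
        · simp only [Pi.add_apply, mul_add]
        · exact (memLp_of_continuous hg.continuous 0 L 2).integrable_mul h1
        · exact (memLp_of_continuous hg.continuous 0 L 2).integrable_mul h2
      have e3 : ∫ s in Ioo 0 1, η s * (moment L g (fun q => v q 1) s * t1 s +
          moment L g (fun q => v q 2) s * t2 s) = ∫ s, moment L g ((fun q => v q 1 * t1 q.2) +
          fun q => v q 2 * t2 q.2) s * η s ∂muS := by
        refine integral_congr_ae ?_
        filter_upwards [e2] with s hs
        rw [hs, mul_comm]
      rw [e3, ← e1]
      refine Eq.trans (integral_congr_ae ?_) h0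
      filter_upwards [ae_muOmega_mem L] with q hq
      rw [inner_E3, hγ.tangent_zero (Ioo_subset_Icc_self hq.2)]
      simp only [Pi.add_apply, t1, t2, g]
      ring)
  have mfh := memLp_moment hf.continuous hh
  refine integral_mul_eq_zero_of_annihilates hγ.continuousOn_curvature hp hp0 hp1 hk (int mfh)
    (int (memLp_moment hg.continuous mb)) (mfh.integrable_mul (memLp_moment hg.continuous mb))
    cΘ cW hΘ dW hW fun V hV hVc hVk => ?_
  have hV'' := (contDiff_infty_iff_deriv.1 (contDiff_infty_iff_deriv.1 hV).2).2.continuous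
  have e := integral_mul_eq_integral_moment hf.continuous hh (memLp_of_continuous hV'' 0 1 2)
  simp only [mul_comm _ (moment L f _ _)]
  rw [← e]
  refine Eq.trans (integral_congr_ae (Eventually.of_forall fun q => ?_)) (H f V hf hV hVc hVk)
  ring

/-- A square integrable function orthogonal to all bending moments of smooth infinitesimal
isometries is orthogonal to `𝓑`. -/
theorem integral_mul_eq_zero_of_mem_classB (hL : 0 < L) (hγ : IsSimplePlanarCurve γ)
    {m : ℕ} {p : Fin (m + 1) → ℝ} (hp : StrictMono p)
    (hp0 : p 0 = 0) (hp1 : p (Fin.last m) = 1)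
    (hk : ∀ i : Fin m, (∀ s ∈ Ioo (p i.castSucc) (p i.succ), curvature γ s ≠ 0) ∨
      (∀ s ∈ Ioo (p i.castSucc) (p i.succ), curvature γ s = 0))
    {b h : ℝ × ℝ → ℝ} (hb : b ∈ classB L γ) (hh : MemLp h 2 (muOmega L))
    (H : ∀ φ β, HasBending L γ φ β → MemLp β 2 (muOmega L) →
      ∫ q, h q * β q ∂(muOmega L) = 0) :
    ∫ q, h q * b q ∂(muOmega L) = 0 := by
  have mb := hb.1
  -- Affine isometries with an arbitrary test function as the factor in `s` force the affine moments
  -- of `h` to vanish.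
  have Haff : ∀ α₀ α₁ : ℝ, ∀ᵐ s ∂muS, moment L (fun x => α₀ + α₁ * x) h s = 0 := by
    intro α₀ α₁
    have hc : Continuous fun x : ℝ => α₀ + α₁ * x := by fun_prop
    refine ae_eq_zero_of_forall_isTestOn ((memLp_moment hc hh).integrable (by norm_num))
      fun η hη => ?_
    obtain ⟨φ, hφ⟩ := exists_hasBending_affine (L := L) hγ α₀ α₁ hη.smooth
    have mη := memLp_of_continuous hη.continuous 0 1 2
    simp only [mul_comm _ (moment L _ _ _)]
    rw [← integral_mul_eq_integral_moment hc hh mη]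
    refine Eq.trans (integral_congr_ae (Eventually.of_forall fun q => ?_))
      (H φ _ hφ (memLp_mul_of_continuous hc (memLp_comp_snd L mη)))
    ring
  obtain ⟨ρ, hρ, hρ1⟩ := exists_isTestOn_integral_eq_one hL
  set X := ∫ y, y * ρ y with hX
  have mρ := memLp_moment hρ.continuous mb
  have mρ' := memLp_moment hρ.deriv.continuous mb
  have cX : Continuous fun x : ℝ => X + (-1) * x := by fun_prop
  have ma : MemLp (fun q : ℝ × ℝ => moment L ρ b q.2) 2 (muOmega L) := memLp_comp_snd L mρ
  have ma' : MemLp (fun q : ℝ × ℝ => (X + (-1) * q.1) * moment L (deriv ρ) b q.2) 2 (muOmega L) :=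
    memLp_mul_of_continuous cX (memLp_comp_snd L mρ')
  -- The correction is dual to `exists_second_primitive`: it is affine in `x₁`, and the moment of
  -- `c` against `g` is the moment of `b` against `F''`.
  set c : ℝ × ℝ → ℝ := fun q => b q - moment L ρ b q.2 -
    (X + (-1) * q.1) * moment L (deriv ρ) b q.2
  have mc : MemLp c 2 (muOmega L) := (mb.sub ma).sub ma'
  have z1 : ∫ q, h q * moment L ρ b q.2 ∂(muOmega L) = 0 := by
    have e := integral_mul_eq_integral_moment (f := fun x => 1 + 0 * x) (by fun_prop) hh mρ
    have e' : ∫ s, moment L (fun x => 1 + 0 * x) h s * moment L ρ b s ∂muS = 0 :=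
      integral_eq_zero_of_ae (by filter_upwards [Haff 1 0] with s hs; rw [hs, zero_mul, Pi.zero_apply])
    rw [e'] at e
    simpa using e
  have z2 : ∫ q, h q * ((X + (-1) * q.1) * moment L (deriv ρ) b q.2) ∂(muOmega L) = 0 := by
    have e := integral_mul_eq_integral_moment cX hh mρ'
    have e' : ∫ s, moment L (fun x => X + (-1) * x) h s * moment L (deriv ρ) b s ∂muS = 0 :=
      integral_eq_zero_of_ae (by filter_upwards [Haff X (-1)] with s hs; rw [hs, zero_mul, Pi.zero_apply])
    refine Eq.trans (integral_congr_ae (Eventually.of_forall fun q => ?_)) (e.trans e')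
    ring
  have hbc : ∫ q, h q * c q ∂(muOmega L) = ∫ q, h q * b q ∂(muOmega L) := by
    have i0 : Integrable (fun q => h q * b q) (muOmega L) := hh.integrable_mul mb
    have i1 : Integrable (fun q => h q * moment L ρ b q.2) (muOmega L) := hh.integrable_mul ma
    have i2 : Integrable (fun q => h q * ((X + (-1) * q.1) * moment L (deriv ρ) b q.2))
      (muOmega L) := hh.integrable_mul ma'
    have i01 : Integrable (fun q => h q * b q - h q * moment L ρ b q.2) (muOmega L) := i0.sub i1
    simp only [c, mul_sub]
    rw [integral_sub i01 i2, integral_sub i0 i1, z1, z2]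
    ring
  rw [← hbc]
  refine integral_mul_eq_zero_of_moments hh mc fun f g hf hg => ?_
  obtain ⟨F, hF, hFg⟩ := exists_second_primitive hρ hρ1 hg
  refine Eq.trans ?_ (integral_moment_mul_moment_eq_zero hγ hp hp0 hp1 hk hb hh
    (fun f W hf hW _ hWk => H _ _ (hasBending_normal hγ hf.smooth hW hWk) ?_) hf hF)
  · refine integral_congr_ae ?_
    filter_upwards [ae_memLp_slice_right mb] with s hs
    congr 1
    have j : ∀ {k : ℝ → ℝ}, IsTestOn 0 L k → Integrable (fun x => k x * b (x, s)) (muX L) :=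
      fun hk => (memLp_of_continuous hk.continuous 0 L 2).integrable_mul hs
    have j0 := hg.integrable.integrableOn (s := Ioo 0 L)
    have j1 : IntegrableOn (fun x => g x * x) (Ioo 0 L) :=
      (hg.mul_smooth contDiff_id).integrable.integrableOn
    have s0 : ∫ x, g x ∂(muX L) = ∫ x, g x := by simpa using hg.setIntegral_mul fun _ => 1
    have s1 : ∫ x, g x * x ∂(muX L) = ∫ x, x * g x := by
      rw [hg.setIntegral_mul fun x => x]
      simp only [mul_comm]
    set M := moment L ρ b s with hM
    set M' := moment L (deriv ρ) b s with hM'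
    have l : moment L g c s =
        moment L g b s - (M + X * M') * (∫ x, g x) + M' * ∫ x, x * g x := by
      have e : ∀ x, g x * c (x, s) = g x * b (x, s) - (M + X * M') * g x + M' * (g x * x) :=
        fun x => by simp only [c, ← hM, ← hM']; ring
      have i01 : Integrable (fun x => g x * b (x, s) - (M + X * M') * g x) (muX L) :=
        (j hg).sub (j0.const_mul _)
      rw [moment]
      simp only [e]
      rw [integral_add i01 (j1.const_mul _), integral_sub (j hg) (j0.const_mul _),
        integral_const_mul, integral_const_mul, s0, s1, moment]
    have r : moment L (deriv (deriv F)) b s =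
        moment L g b s - (∫ x, g x) * M - (X * (∫ x, g x) - ∫ x, x * g x) * M' := by
      have e : ∀ x, deriv (deriv F) x * b (x, s) = g x * b (x, s) - (∫ y, g y) * (ρ x * b (x, s)) -
        (X * (∫ y, g y) - ∫ y, y * g y) * (deriv ρ x * b (x, s)) :=
        fun x => by rw [hFg, ← hX]; ring
      have i01 : Integrable (fun x => g x * b (x, s) - (∫ y, g y) * (ρ x * b (x, s))) (muX L) :=
        (j hg).sub ((j hρ).const_mul _)
      rw [moment]
      simp only [e]
      rw [integral_sub i01 ((j hρ.deriv).const_mul _), integral_sub (j hg) ((j hρ).const_mul _),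
        integral_const_mul, integral_const_mul]
      rfl
    rw [l, r]
    ring
  · have hW'' := (contDiff_infty_iff_deriv.1 (contDiff_infty_iff_deriv.1 hW).2).2.continuous
    exact memLp_mul_of_continuous hf.continuous
      (memLp_comp_snd L (memLp_of_continuous hW'' 0 1 2))

/-- The bending moments of infinitesimal isometries of class `C⁵`, as a subspace of `L²(ω)`. -/
def bendingSubmodule (L : ℝ) (γ : ℝ → E3) : Submodule ℝ (Lp ℝ 2 (muOmega L)) where
  carrier := {g | ∃ φ β, HasBending L γ φ β ∧ g =ᵐ[muOmega L] β}
  zero_mem' := ⟨_, _, HasBending.zero, Lp.coeFn_zero _ _ _⟩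
  add_mem' := by
    rintro g g' ⟨φ, β, h, e⟩ ⟨φ', β', h', e'⟩
    refine ⟨_, _, h.add h', ?_⟩
    filter_upwards [Lp.coeFn_add g g', e, e'] with q h1 h2 h3
    rw [h1, Pi.add_apply, h2, h3]
  smul_mem' := by
    rintro c g ⟨φ, β, h, e⟩
    refine ⟨_, _, h.smul c, ?_⟩
    filter_upwards [Lp.coeFn_smul c g, e] with q h1 h2
    rw [h1, Pi.smul_apply, h2, smul_eq_mul]

/-- The closure of a subspace is its double orthogonal, so density reduces to the orthogonality of
`b` to every annihilator `h`. -/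
theorem toLp_mem_closure_bendingSubmodule (hL : 0 < L) (hγ : IsSimplePlanarCurve γ)
    {m : ℕ} {p : Fin (m + 1) → ℝ} (hp : StrictMono p)
    (hp0 : p 0 = 0) (hp1 : p (Fin.last m) = 1)
    (hk : ∀ i : Fin m, (∀ s ∈ Ioo (p i.castSucc) (p i.succ), curvature γ s ≠ 0) ∨
      (∀ s ∈ Ioo (p i.castSucc) (p i.succ), curvature γ s = 0))
    {b : ℝ × ℝ → ℝ} (hb : b ∈ classB L γ) :
    hb.1.toLp b ∈ (bendingSubmodule L γ).topologicalClosure := by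
  rw [← Submodule.orthogonal_orthogonal_eq_closure, Submodule.mem_orthogonal]
  intro h hh
  have e := integral_mul_eq_zero_of_mem_classB hL hγ hp hp0 hp1 hk hb (Lp.memLp h)
    fun φ β hφ hβ => ?_
  · rw [real_inner_comm, inner_toLp_left_eq_integral, ← e]
    simp only [mul_comm]
  · have h1 := (Submodule.mem_orthogonal _ _).1 hh (hβ.toLp β) ⟨φ, β, hφ, hβ.coeFn_toLp⟩
    rw [inner_toLp_left_eq_integral] at h1
    rw [← h1]
    simp only [mul_comm]

end ThinBeam

end

/-! ### The approximating family -/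

theorem mainTheorem10 (L : ℝ) (hL : 0 < L) (γ : ℝ → ThinBeam.E3)
    (hγ : ThinBeam.IsSimplePlanarCurve γ)
    (m : ℕ) (p : Fin (m + 1) → ℝ) (hp : StrictMono p) (hp0 : p 0 = 0) (hp1 : p (Fin.last m) = 1)
    (hk : ∀ i : Fin m,
      (∀ s ∈ Ioo (p i.castSucc) (p i.succ), 0 < ThinBeam.curvature γ s) ∨
      (∀ s ∈ Ioo (p i.castSucc) (p i.succ), ThinBeam.curvature γ s < 0) ∨
      (∀ s ∈ Ioo (p i.castSucc) (p i.succ), ThinBeam.curvature γ s = 0))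
    (b : ℝ × ℝ → ℝ) (hb : b ∈ ThinBeam.classB L γ) :
    ∃ φ : ℝ → ℝ × ℝ → ThinBeam.E3,
      (∀ ε : ℝ, 0 < ε →
        ContDiffOn ℝ 5 (φ ε) (ThinBeam.omegaBar L) ∧
        (∀ q ∈ ThinBeam.omega L, ThinBeam.symGrad γ (φ ε) q = 0) ∧
        MemLp (ThinBeam.bending γ (φ ε)) 2 (ThinBeam.muOmega L)) ∧
      Tendsto
        (fun ε : ℝ => eLpNorm (fun q => ThinBeam.bending γ (φ ε) q - b q) 2 (ThinBeam.muOmega L))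
        (𝓝[>] 0) (𝓝 0) := by
  have hk' : ∀ i : Fin m,
      (∀ s ∈ Ioo (p i.castSucc) (p i.succ), ThinBeam.curvature γ s ≠ 0) ∨
      (∀ s ∈ Ioo (p i.castSucc) (p i.succ), ThinBeam.curvature γ s = 0) := fun i =>
    (hk i).elim (fun h => Or.inl fun s hs => (h s hs).ne')
      fun h => h.imp (fun h s hs => (h s hs).ne) id
  have hcl := ThinBeam.toLp_mem_closure_bendingSubmodule hL hγ hp hp0 hp1 hk' hb
  -- The condition `0 < ε` sits inside the existential so that a displacement can be chosen for
  -- every real `ε`; for `ε ≤ 0` it is the zero map.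
  have key : ∀ ε : ℝ, ∃ φ : ℝ × ℝ → ThinBeam.E3, 0 < ε →
      (ContDiffOn ℝ 5 φ (ThinBeam.omegaBar L) ∧
        (∀ q ∈ ThinBeam.omega L, ThinBeam.symGrad γ φ q = 0) ∧
        MemLp (ThinBeam.bending γ φ) 2 (ThinBeam.muOmega L)) ∧
      eLpNorm (fun q => ThinBeam.bending γ φ q - b q) 2 (ThinBeam.muOmega L) ≤
        ENNReal.ofReal ε := by
    intro ε
    by_cases hε : 0 < ε
    · obtain ⟨g, ⟨φ, β, hφ, hg⟩, hd⟩ := Metric.mem_closure_iff.1 hcl ε hε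
      obtain ⟨hsym, hbend⟩ := hφ.pds_eq hγ
      have hae : g =ᵐ[ThinBeam.muOmega L] ThinBeam.bending γ φ := by
        filter_upwards [hg, ThinBeam.ae_muOmega_mem L] with q h1 h2
        rw [h1, hbend q h2]
      refine ⟨φ, fun _ => ⟨⟨hφ.1, hsym, (Lp.memLp g).ae_eq hae⟩, ?_⟩⟩
      rw [dist_comm, Lp.dist_def] at hd
      refine le_of_eq_of_le (eLpNorm_congr_ae ?_)
        ((ENNReal.le_ofReal_iff_toReal_le ?_ hε.le).2 hd.le)
      · filter_upwards [hae, hb.1.coeFn_toLp] with q h1 h2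
        rw [Pi.sub_apply, h1, h2]
      · exact ((Lp.memLp g).sub (Lp.memLp _)).eLpNorm_ne_top
    · exact ⟨0, fun h => absurd h hε⟩
  choose φ hφ using key
  refine ⟨φ, fun ε hε => (hφ ε hε).1, ?_⟩
  have h0 : Tendsto (fun ε : ℝ => ENNReal.ofReal ε) (𝓝[>] 0) (𝓝 0) := by
    have := (ENNReal.continuous_ofReal.tendsto 0).mono_left
      (nhdsWithin_le_nhds (s := Ioi (0 : ℝ)))
    rwa [ENNReal.ofReal_zero] at this
  refine tendsto_of_tendsto_of_tendsto_of_le_of_le' tendsto_const_nhds h0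
    (Eventually.of_forall fun _ => zero_le) ?_
  filter_upwards [self_mem_nhdsWithin] with ε hε using (hφ ε hε).2
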